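/- Let $\mathbb K=\mathbb R$ or $\mathbb C$ and consider an autonomous differential-difference equation $$(u_{i+1})_x=F\bigl(x,u_i,u_{i+1},(u_i)_x\bigr),\qquad i\in\mathbb Z,\qquad F_{u_x}\neq 0,$$ where $F$ is analytic on an open set $\Omega\subset\mathbb K^4$ and $F=F(x,u,u_1,u_x)$ is, on $\Omega$, injective in $u_x$ for fixed $(x,u,u_1)$. Write $u_p=u_{i+p}$ and $u^{(q)}=\partial_x^q u_i$. The dynamical variables are $u_p$ ($p\in\mathbb Z$) and $u^{(q)}$ ($q\ge 1$); all other derivatives of shifts of $u$ are expressed through them by the equation. The equation is considered at the values of $x$ and of the dynamical variables for which $(x,u_p,u_{p+1},(u_p)_x)\in\Omega$ and $(u_{p+1})_x=F(x,u_p,u_{p+1},(u_p)_x)$ for all $p\in\mathbb Z$, and it is assumed that any finite number of the variables $x,u_p,u^{(q)}$ then range over a (nonempty) connected open set. Let $g[u]$ denote a function of $x$ and finitely many dynamical variables that is a quotient of two analytic functions (with denominator not identically zero), and $f_i[u]$ a function that may in addition depend explicitly on $i\in\mathbb Z$, the finite set of dynamical variables being the same for all $i$. Let $D$ be the total derivative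 with respect to $x$ and $T$ the shift $i\mapsto i+1$, both by virtue of the equation (so $T(f_i)(x,u,\dots)=f_{i+1}(x,T(u),\dots)$, $T(u_p)=u_{p+1}$, $T(u^{(q)})=D^{q-1}(F)$), and put $$L=TD-F_{u_x}D-F_{u_1}T-F_u .$$ A function $f_i[u]$ is a *symmetry* if $L(f_i)=0$ for all $i$. * An *$x$-symmetry driver* is an operator $S=\sum_{k=0}^{\sigma}\alpha_k[u]D^k$, $\sigma\ge 0$, $\alpha_\sigma\ne0$, such that $S(\xi)$ is a symmetry for every $\xi_i[u]\in\ker(T-1)$; an *$i$-symmetry driver* is an operator $R=\sum_{k=0}^{r}\lambda_k[u]T^k$, $r\ge0$, $\lambda_r\neq0$, such that $R(\eta)$ is a symmetry for every $\eta_i[u]\in\ker D$. * A *formal $i$-integral* is an operator $\mathcal I=\sum_{k=0}^{m}\mu_k[u]T^k$, $m>0$, $\mu_m\neq0$, such that $D\mathcal I=\sum_{k=0}^{m-1}\nu_k[u]T^kL$ for some functions $\nu_k[u]$; a *formal $x$-integral* is an operator $\mathcal X=\sum_{k=0}^{n}\beta_k[u]D^k$, $n>0$, $\beta_n\neq0$,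 such that $(T-1)\mathcal X=\sum_{k=0}^{n-1}\gamma_k[u]D^kL$ for some functions $\gamma_k[u]$. (These are identities between operators acting on the functions $f_i[u]$.) **Theorem.** The equation admits both a formal $i$-integral and a formal $x$-integral if and only if it admits both an $i$-symmetry driver and an $x$-symmetry driver. -/

import Mathlib

namespace SemiDiscrete

/-- The independent variable `x` together with the dynamical variables:
`u p` stands for the shift `u_p = u_{i+p}` (so `u 0` is `u` itself), and `d q` stands for the
derivative `u^{(q+1)} = ∂^{q+1} u_i / ∂x^{q+1}`. -/
inductive DynVar : Type
  | x : DynVar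
  | u (p : ℤ) : DynVar
  | d (q : ℕ) : DynVar
  deriving DecidableEq

/-- The right-hand side of an autonomous differential-difference equation
`(u_{i+1})_x = F(x, u_i, u_{i+1}, (u_i)_x)`: a function `F` of the four arguments
`(x, u, u_1, u_x)`, indexed by `0, 1, 2, 3`, considered on a domain `dom`. -/
structure PreEquation (𝕜 : Type*) [RCLike 𝕜] where
  dom : Set (Fin 4 → 𝕜)
  F : (Fin 4 → 𝕜) → 𝕜

namespace PreEquation

variable {𝕜 : Type*} [RCLike 𝕜]

/-- A point of the space of the dynamical variables: the values of `x`, of all the shifts `u_p`,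
of their first derivatives `(u_p)_x` and of the higher derivatives `higher q = u^{(q+2)}` of
`u = u_0`. The values `(u_p)_x`, `p ≠ 0`, are not free: they are tied to `u_x = (u_0)_x` by the
equation, which is required to make sense at every `p`. -/
@[ext]
structure Point (E : PreEquation 𝕜) where
  x : 𝕜
  u : ℤ → 𝕜
  ux : ℤ → 𝕜
  higher : ℕ → 𝕜
  mem_dom : ∀ p : ℤ, ![x, u p, u (p + 1), ux p] ∈ E.dom
  eqn : ∀ p : ℤ, ux (p + 1) = E.F ![x, u p, u (p + 1), ux p]

variable {E : PreEquation 𝕜}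

/-- The value of a (dynamical) variable at a point. -/
def coord : DynVar → E.Point → 𝕜
  | .x, P => P.x
  | .u p, P => P.u p
  | .d 0, P => P.ux 0
  | .d (q + 1), P => P.higher q

/-- The derivative of a (dynamical) variable with respect to `x` by virtue of the equation. -/
def coordDeriv : DynVar → E.Point → 𝕜
  | .x, _ => 1
  | .u p, P => P.ux p
  | .d q, P => coord (.d (q + 1)) P

/-- The values of finitely many variables at a point. -/
def proj (s : Finset DynVar) (P : E.Point) : s → 𝕜 := fun c => coord c.1 P

/-- The arguments `(x, u, u_1, u_x)` of `F` at a point. -/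
def base (P : E.Point) : Fin 4 → 𝕜 := ![P.x, P.u 0, P.u 1, P.ux 0]

/-- `f` is an analytic function of the finitely many variables in `s`. -/
def DependsAnalytically (s : Finset DynVar) (f : E.Point → 𝕜) : Prop :=
  ∃ g : (s → 𝕜) → 𝕜, AnalyticOnNhd 𝕜 g (Set.range (proj (E := E) s)) ∧
    ∀ P : E.Point, f P = g (proj s P)

theorem DependsAnalytically.mono {s t : Finset DynVar} (h : s ⊆ t) {f : E.Point → 𝕜}
    (hf : DependsAnalytically s f) : DependsAnalytically t f := by
  obtain ⟨g, hg, hfg⟩ := hf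
  let r : (t → 𝕜) →L[𝕜] (s → 𝕜) :=
    ContinuousLinearMap.pi fun c => ContinuousLinearMap.proj (⟨c.1, h c.2⟩ : t)
  refine ⟨g ∘ r, ?_, fun P => ?_⟩
  · rintro _ ⟨P, rfl⟩
    exact AnalyticAt.comp (hg _ ⟨P, rfl⟩) (r.analyticAt _)
  · rw [hfg]; rfl

theorem DependsAnalytically.comp {ι : Type*} [Fintype ι] {h : (ι → 𝕜) → 𝕜}
    {y : ι → E.Point → 𝕜} {f : E.Point → 𝕜} (hy : ∀ j, ∃ s, DependsAnalytically s (y j))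
    (hh : ∀ P, AnalyticAt 𝕜 h fun j => y j P) (hf : ∀ P, f P = h fun j => y j P) :
    ∃ s, DependsAnalytically s f := by
  choose s hs using hy
  have hs' : ∀ j, DependsAnalytically (Finset.univ.biUnion s) (y j) := fun j =>
    (hs j).mono (Finset.subset_biUnion_of_mem s (Finset.mem_univ j))
  choose g hg hfg using hs'
  refine ⟨_, fun z => h fun j => g j z, ?_, fun P => by simp only [hf, hfg]⟩
  rintro _ ⟨P, rfl⟩
  have h1 : AnalyticAt 𝕜 (fun z => fun j => g j z) (proj (Finset.univ.biUnion s) P) :=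
    AnalyticAt.pi fun j => hg j _ ⟨P, rfl⟩
  refine AnalyticAt.fun_comp (f := fun z => fun j => g j z) ?_ h1
  have := hh P
  simp only [hfg] at this
  exact this

theorem analyticAt_apply {ι : Type*} [Fintype ι] (j : ι) {z : ι → 𝕜} :
    AnalyticAt 𝕜 (fun w : ι → 𝕜 => w j) z :=
  (ContinuousLinearMap.proj (R := 𝕜) (φ := fun _ : ι => 𝕜) j).analyticAt z

theorem dependsAnalytically_coord (c : DynVar) :
    ∃ s, DependsAnalytically s (coord (E := E) c) :=
  ⟨{c}, fun z => z ⟨c, by simp⟩, fun _ _ => analyticAt_apply _, fun _ => rfl⟩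

end PreEquation

open PreEquation

/-- An autonomous differential-difference equation `(u_{i+1})_x = F(x, u_i, u_{i+1}, (u_i)_x)`
with analytic right-hand side, `F_{u_x} ≠ 0`, uniquely solvable for `(u_i)_x`, whose dynamical
variables (any finite number of them, together with `x`) range over open connected sets. -/
structure Equation (𝕜 : Type*) [RCLike 𝕜] extends PreEquation 𝕜 where
  isOpen_dom : IsOpen dom
  analytic : AnalyticOnNhd 𝕜 F dom
  deriv_ne_zero : ∀ y ∈ dom, fderiv 𝕜 F y (Pi.single 3 1) ≠ 0
  solvable : ∀ y ∈ dom, ∀ z ∈ dom, y 0 = z 0 → y 1 = z 1 → y 2 = z 2 → F y = F z → y = z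
  isOpen_range : ∀ s : Finset DynVar, IsOpen (Set.range (proj (E := toPreEquation) s))
  isConnected_range : ∀ s : Finset DynVar, IsConnected (Set.range (proj (E := toPreEquation) s))

namespace Equation

variable {𝕜 : Type*} [RCLike 𝕜]

/-- The ring of the analytic functions of `x` and finitely many dynamical variables. -/
def analyticFun (E : Equation 𝕜) : Subring (E.Point → 𝕜) where
  carrier := {f | ∃ s, DependsAnalytically s f}
  mul_mem' {a b} ha hb :=
    DependsAnalytically.comp (h := fun z : Fin 2 → 𝕜 => z 0 * z 1) (y := ![a, b])
      (by intro j; fin_cases j <;> assumption)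
      (fun P => (analyticAt_apply 0).fun_mul (analyticAt_apply 1)) (fun P => rfl)
  one_mem' := ⟨∅, fun _ => 1, fun _ _ => analyticAt_const, fun _ => rfl⟩
  add_mem' {a b} ha hb :=
    DependsAnalytically.comp (h := fun z : Fin 2 → 𝕜 => z 0 + z 1) (y := ![a, b])
      (by intro j; fin_cases j <;> assumption)
      (fun P => (analyticAt_apply 0).fun_add (analyticAt_apply 1)) (fun P => rfl)
  zero_mem' := ⟨∅, fun _ => 0, fun _ _ => analyticAt_const, fun _ => rfl⟩
  neg_mem' {a} ha :=
    DependsAnalytically.comp (h := fun z : Fin 1 → 𝕜 => - z 0) (y := ![a])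
      (by intro j; fin_cases j; assumption)
      (fun P => (analyticAt_apply 0).fun_neg) (fun P => rfl)

variable {E : Equation 𝕜}

instance : Nontrivial E.analyticFun := by
  obtain ⟨_, P, -⟩ := (E.isConnected_range ∅).nonempty
  refine ⟨0, 1, fun h => ?_⟩
  have := congrArg (fun f : E.analyticFun => f.1 P) h
  simp at this

instance : NoZeroDivisors E.analyticFun where
  eq_zero_or_eq_zero_of_mul_eq_zero {a b} hab := by
    classical
    by_contra! hne
    obtain ⟨s, hs⟩ := a.2
    obtain ⟨t, ht⟩ := b.2
    obtain ⟨g, hg, hag⟩ := hs.mono (Finset.subset_union_left (s₂ := t))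
    obtain ⟨h, hh, hbh⟩ := ht.mono (Finset.subset_union_right (s₁ := s))
    have hU := E.isOpen_range (s ∪ t)
    have hmul : ∀ z ∈ Set.range (proj (E := E.toPreEquation) (s ∪ t)), g z * h z = 0 := by
      rintro _ ⟨P, rfl⟩
      rw [← hag, ← hbh]
      exact congrFun (congrArg Subtype.val hab) P
    obtain ⟨P, hP⟩ : ∃ P, a.1 P ≠ 0 := by
      by_contra! h0
      exact hne.1 (Subtype.ext (funext h0))
    have hev : ∀ᶠ z in nhds (proj (s ∪ t) P), h z = 0 := by
      rw [hag] at hP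
      filter_upwards [(hg _ ⟨P, rfl⟩).continuousAt.eventually_ne hP,
        hU.mem_nhds ⟨P, rfl⟩] with z hz hzU
      exact (mul_eq_zero.1 (hmul z hzU)).resolve_left hz
    have := hh.eqOn_zero_of_preconnected_of_eventuallyEq_zero
      (E.isConnected_range _).isPreconnected ⟨P, rfl⟩ hev
    exact hne.2 (Subtype.ext (funext fun Q => by rw [hbh]; exact this ⟨Q, rfl⟩))

instance : IsDomain E.analyticFun := NoZeroDivisors.to_isDomain _

/-- The functions `g[u]`: quotients of analytic functions of `x` and finitely many dynamical
variables (the denominator is not identically zero). -/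
abbrev Fun (E : Equation 𝕜) : Type _ := FractionRing E.analyticFun

theorem base_mem (P : E.Point) : base P ∈ E.dom := by
  simpa [base] using P.mem_dom 0

theorem comp_base_mem {h : (Fin 4 → 𝕜) → 𝕜} (hh : AnalyticOnNhd 𝕜 h E.dom) :
    (fun P : E.Point => h (base P)) ∈ E.analyticFun :=
  DependsAnalytically.comp (E := E.toPreEquation) (h := h) (y := fun j P => base P j)
    (by
      intro j
      fin_cases j
      · exact dependsAnalytically_coord (E := E.toPreEquation) .x
      · exact dependsAnalytically_coord (E := E.toPreEquation) (.u 0)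
      · exact dependsAnalytically_coord (E := E.toPreEquation) (.u 1)
      · exact dependsAnalytically_coord (E := E.toPreEquation) (.d 0))
    (fun P => hh _ (base_mem P)) (fun _ => rfl)

/-- The right-hand side `F` as a function of the dynamical variables. -/
def rhs (E : Equation 𝕜) : E.analyticFun := ⟨fun P => E.F (base P), comp_base_mem E.analytic⟩

/-- The partial derivative of `F` with respect to its argument number `j`. -/
noncomputable def rhsPartial (E : Equation 𝕜) (j : Fin 4) : E.analyticFun :=
  ⟨fun P => fderiv 𝕜 E.F (base P) (Pi.single j 1),
    comp_base_mem (h := fun y => fderiv 𝕜 E.F y (Pi.single j 1)) fun y hy =>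
      ((ContinuousLinearMap.apply 𝕜 𝕜 (Pi.single j 1 : Fin 4 → 𝕜)).analyticAt _).fun_comp
        (E.analytic y hy).fderiv⟩

/-- `F_u` -/
noncomputable def Fu (E : Equation 𝕜) : E.Fun := algebraMap _ _ (E.rhsPartial 1)
/-- `F_{u_1}` -/
noncomputable def Fu1 (E : Equation 𝕜) : E.Fun := algebraMap _ _ (E.rhsPartial 2)
/-- `F_{u_x}` -/
noncomputable def Fux (E : Equation 𝕜) : E.Fun := algebraMap _ _ (E.rhsPartial 3)

/-- Locally, the equation can be solved for `u_x` analytically. -/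
theorem exists_analytic_inverse (E : Equation 𝕜) :
    ∃ G : (Fin 4 → 𝕜) → 𝕜, ∀ y ∈ E.dom,
      AnalyticAt 𝕜 G (Function.update y 3 (E.F y)) ∧ G (Function.update y 3 (E.F y)) = y 3 := by
  classical
  let Ψ : (Fin 4 → 𝕜) → (Fin 4 → 𝕜) := fun y => Function.update y 3 (E.F y)
  have hinj : Set.InjOn Ψ E.dom := by
    intro y hy z hz hyz
    have h0 := congrFun hyz 0
    have h1 := congrFun hyz 1
    have h2 := congrFun hyz 2
    have h3 := congrFun hyz 3
    simp [Ψ] at h0 h1 h2 h3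
    exact E.solvable y hy z hz h0 h1 h2 h3
  let I := Function.invFunOn Ψ E.dom
  have hI : ∀ y ∈ E.dom, I (Ψ y) = y := fun y hy => hinj.leftInvOn_invFunOn hy
  refine ⟨fun z => I z 3, fun y hy => ⟨?_, congrFun (hI y hy) 3⟩⟩
  have hΨa : AnalyticAt 𝕜 Ψ y := by
    refine AnalyticAt.pi fun j => ?_
    by_cases hj : j = 3
    · subst hj; simpa [Ψ] using E.analytic y hy
    · simp only [Function.update_of_ne hj]
      exact analyticAt_apply j
  have hder : ∀ v, fderiv 𝕜 Ψ y v = Function.update v 3 (fderiv 𝕜 E.F y v) := by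
    intro v
    have hd : HasFDerivAt Ψ (ContinuousLinearMap.pi fun j : Fin 4 =>
        if j = 3 then fderiv 𝕜 E.F y else ContinuousLinearMap.proj j) y := by
      rw [hasFDerivAt_pi']
      intro j
      by_cases hj : j = 3
      · subst hj
        simpa [Ψ] using (E.analytic y hy).differentiableAt.hasFDerivAt
      · simp only [Ψ, Function.update_of_ne hj, ContinuousLinearMap.proj_pi, hj, if_false]
        exact (ContinuousLinearMap.proj (R := 𝕜) (φ := fun _ : Fin 4 => 𝕜) j).hasFDerivAt
    rw [hd.fderiv]
    ext j
    by_cases hj : j = 3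
    · subst hj; simp
    · simp [hj]
  have hker : Function.Injective (fderiv 𝕜 Ψ y) := by
    rw [injective_iff_map_eq_zero]
    intro v hv
    rw [hder] at hv
    have hj : ∀ j, j ≠ 3 → v j = 0 := fun j hj => by
      simpa [Function.update_of_ne hj] using congrFun hv j
    have hv3 : v = v 3 • Pi.single 3 1 := by
      ext j
      by_cases h : j = 3
      · subst h; simp
      · simp [hj j h, h]
    have h3 : fderiv 𝕜 E.F y v = 0 := by simpa using congrFun hv 3
    rw [hv3, map_smul, smul_eq_mul] at h3
    rw [hv3, (mul_eq_zero.1 h3).resolve_right (E.deriv_ne_zero y hy), zero_smul]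
  let L : (Fin 4 → 𝕜) ≃L[𝕜] (Fin 4 → 𝕜) :=
    (LinearEquiv.ofInjectiveEndo (fderiv 𝕜 Ψ y).toLinearMap hker).toContinuousLinearEquiv
  have hL : (L : (Fin 4 → 𝕜) →L[𝕜] (Fin 4 → 𝕜)) = fderiv 𝕜 Ψ y := by
    ext v; rfl
  have hstrict : HasStrictFDerivAt Ψ (L : (Fin 4 → 𝕜) →L[𝕜] (Fin 4 → 𝕜)) y := by
    rw [hL]; exact hΨa.hasStrictFDerivAt
  let R := hstrict.toOpenPartialHomeomorph Ψ
  have hyR : y ∈ R.source := hstrict.mem_toOpenPartialHomeomorph_source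
  have hRa : AnalyticAt 𝕜 R.symm (Ψ y) :=
    R.analyticAt_symm' (i := L) hyR hΨa hL.symm
  have hΨt : Ψ y ∈ R.target := R.map_source hyR
  have hRy : R.symm (Ψ y) = y := R.left_inv hyR
  have hev : R.symm =ᶠ[nhds (Ψ y)] I := by
    have hc : ∀ᶠ z in nhds (Ψ y), R.symm z ∈ E.dom :=
      hRa.continuousAt.eventually_mem (E.isOpen_dom.mem_nhds (by rw [hRy]; exact hy))
    filter_upwards [hc, R.open_target.mem_nhds hΨt] with z hz hzt
    have : Ψ (R.symm z) = z := R.right_inv hzt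
    rw [← hI _ hz, this]
  exact (analyticAt_apply 3).fun_comp (hRa.congr hev)

theorem ux_mem (p : ℤ) : (fun P : E.Point => P.ux p) ∈ E.analyticFun := by
  induction p using Int.induction_on with
  | zero => exact dependsAnalytically_coord (E := E.toPreEquation) (.d 0)
  | succ n ih =>
    refine DependsAnalytically.comp (E := E.toPreEquation) (h := E.F)
      (y := fun j P => ![P.x, P.u n, P.u (n + 1), P.ux n] j) ?_
      (fun P => E.analytic _ (P.mem_dom n)) (fun P => P.eqn n)
    intro j
    fin_cases j
    · exact dependsAnalytically_coord (E := E.toPreEquation) .x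
    · exact dependsAnalytically_coord (E := E.toPreEquation) (.u n)
    · exact dependsAnalytically_coord (E := E.toPreEquation) (.u (n + 1))
    · exact ih
  | pred n ih =>
    obtain ⟨G, hG⟩ := E.exists_analytic_inverse
    have key : ∀ P : E.Point,
        ![P.x, P.u (-n - 1), P.u (-n), P.ux (-n)] =
        Function.update ![P.x, P.u (-n - 1), P.u (-n - 1 + 1), P.ux (-n - 1)] 3
          (E.F ![P.x, P.u (-n - 1), P.u (-n - 1 + 1), P.ux (-n - 1)]) := by
      intro P
      rw [← P.eqn]
      ext j; fin_cases j <;> simp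
    refine DependsAnalytically.comp (E := E.toPreEquation) (h := G)
      (y := fun j P => ![P.x, P.u (-n - 1), P.u (-n), P.ux (-n)] j) ?_
      (fun P => ?_) (fun P => ?_)
    · intro j
      fin_cases j
      · exact dependsAnalytically_coord (E := E.toPreEquation) .x
      · exact dependsAnalytically_coord (E := E.toPreEquation) (.u (-n - 1))
      · exact dependsAnalytically_coord (E := E.toPreEquation) (.u (-n))
      · exact ih
    · show AnalyticAt 𝕜 G ![P.x, P.u (-n - 1), P.u (-n), P.ux (-n)]
      rw [key]; exact (hG _ (P.mem_dom _)).1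
    · show _ = G ![P.x, P.u (-n - 1), P.u (-n), P.ux (-n)]
      rw [key, (hG _ (P.mem_dom _)).2]
      simp

theorem coordDeriv_mem (c : DynVar) : coordDeriv (E := E.toPreEquation) c ∈ E.analyticFun := by
  cases c with
  | x => exact one_mem _
  | u p => exact ux_mem p
  | d q => exact dependsAnalytically_coord (E := E.toPreEquation) (.d (q + 1))

theorem exists_dependsAnalytically (f : E.analyticFun) :
    ∃ s, DependsAnalytically s f.1 := f.2

/-- The total derivative with respect to `x` by virtue of the equation, on analytic functions:
if `f = g(c_1, …, c_n)` for variables `c_1, …, c_n`, then `D f = ∑ g_{c_j} · (c_j)_x`. -/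
noncomputable def totalDeriv (f : E.analyticFun) : E.analyticFun :=
  let s := (exists_dependsAnalytically f).choose
  let g := (exists_dependsAnalytically f).choose_spec.choose
  have hg := (exists_dependsAnalytically f).choose_spec.choose_spec.1
  ⟨fun P => ∑ c : s, fderiv 𝕜 g (proj s P) (Pi.single c 1) * coordDeriv c.1 P, by
    have := E.analyticFun.sum_mem (t := Finset.univ)
      (f := fun (c : s) (P : E.Point) =>
        fderiv 𝕜 g (proj s P) (Pi.single c 1) * coordDeriv c.1 P)
      (fun c _ => E.analyticFun.mul_mem
        ⟨s, fun z => fderiv 𝕜 g z (Pi.single c 1), fun z hz =>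
          ((ContinuousLinearMap.apply 𝕜 𝕜 (Pi.single c 1 : s → 𝕜)).analyticAt _).fun_comp
            (hg z hz).fderiv, fun P => rfl⟩
        (coordDeriv_mem c.1))
    convert this using 1
    ext P
    simp⟩

/-- The shift `u_i ↦ u_{i+1}` by virtue of the equation, on points: `u_p ↦ u_{p+1}`,
`u^{(q)} ↦ D^{q-1}(F)` (for `q = 1` this is `u_x ↦ (u_1)_x = F`). -/
noncomputable def shiftPoint (P : E.Point) : E.Point where
  x := P.x
  u p := P.u (p + 1)
  ux p := P.ux (p + 1)
  higher q := (totalDeriv^[q + 1] E.rhs).1 P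
  mem_dom p := P.mem_dom (p + 1)
  eqn p := P.eqn (p + 1)

/-- The shift `T` by virtue of the equation, on analytic functions. -/
noncomputable def shift (f : E.analyticFun) : E.analyticFun :=
  ⟨fun P => f.1 (shiftPoint P), by
    obtain ⟨s, g, hg, hfg⟩ := f.2
    refine DependsAnalytically.comp (E := E.toPreEquation) (h := g)
      (y := fun c P => coord c.1 (shiftPoint P)) ?_
      (fun P => hg _ ⟨shiftPoint P, rfl⟩) (fun P => hfg _)
    rintro ⟨c, hc⟩
    match c with
    | .x => exact dependsAnalytically_coord (E := E.toPreEquation) .x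
    | .u p => exact dependsAnalytically_coord (E := E.toPreEquation) (.u (p + 1))
    | .d 0 => exact ux_mem (0 + 1)
    | .d (q + 1) => exact (totalDeriv^[q + 1] E.rhs).2⟩

/-- The shift `T` on functions `g[u]`: `T(a/b) = T(a)/T(b)`. -/
noncomputable def T (f : E.Fun) : E.Fun :=
  algebraMap _ E.Fun (shift (IsLocalization.sec (nonZeroDivisors E.analyticFun) f).1) /
    algebraMap _ E.Fun (shift (IsLocalization.sec (nonZeroDivisors E.analyticFun) f).2.1)

/-- The total derivative `D` on functions `g[u]`: `D(a/b) = (b D(a) - a D(b))/b²`. -/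
noncomputable def D (f : E.Fun) : E.Fun :=
  let a := (IsLocalization.sec (nonZeroDivisors E.analyticFun) f).1
  let b := (IsLocalization.sec (nonZeroDivisors E.analyticFun) f).2.1
  algebraMap _ E.Fun (b * totalDeriv a - a * totalDeriv b) / algebraMap _ E.Fun b ^ 2

/-- `f = (f_i)` is a function `f_i[u]`: it may depend explicitly on `i`, and for every `i` it is a
function of `x` and of dynamical variables from a finite set that is the same for all `i`. -/
def IsNonautonomousFun (f : ℤ → E.Fun) : Prop :=
  ∃ s : Finset DynVar, ∀ i : ℤ, ∃ a b : E.analyticFun,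
    DependsAnalytically s a.1 ∧ DependsAnalytically s b.1 ∧ b ≠ 0 ∧
      f i = algebraMap _ E.Fun a / algebraMap _ E.Fun b

/-- The shift `T` on functions `f_i[u]`: it also replaces `i` by `i + 1`. -/
noncomputable def Ti (f : ℤ → E.Fun) : ℤ → E.Fun := fun i => T (f (i + 1))

/-- The total derivative `D` on functions `f_i[u]`. -/
noncomputable def Di (f : ℤ → E.Fun) : ℤ → E.Fun := fun i => D (f i)

/-- The linearization operator `L = T D - F_{u_x} D - F_{u_1} T - F_u` of the equation. -/
noncomputable def L (f : ℤ → E.Fun) : ℤ → E.Fun := fun i =>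
  Ti (Di f) i - E.Fux * Di f i - E.Fu1 * Ti f i - E.Fu * f i

/-- The operator `∑_{k < n} a_k[u] T^k`. -/
noncomputable def opT (n : ℕ) (a : ℕ → E.Fun) (f : ℤ → E.Fun) : ℤ → E.Fun := fun i =>
  ∑ k ∈ Finset.range n, a k * (Ti^[k] f) i

/-- The operator `∑_{k < n} a_k[u] D^k`. -/
noncomputable def opD (n : ℕ) (a : ℕ → E.Fun) (f : ℤ → E.Fun) : ℤ → E.Fun := fun i =>
  ∑ k ∈ Finset.range n, a k * (Di^[k] f) i

/-- `f_i[u]` is a symmetry of the equation. -/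
def IsSymmetry (f : ℤ → E.Fun) : Prop := IsNonautonomousFun f ∧ L f = 0

/-- `S = ∑_{k=0}^σ α_k[u] D^k` is an `x`-symmetry driver. -/
def IsXSymmetryDriver (σ : ℕ) (α : ℕ → E.Fun) : Prop :=
  α σ ≠ 0 ∧ ∀ ξ : ℤ → E.Fun, IsNonautonomousFun ξ → Ti ξ = ξ → IsSymmetry (opD (σ + 1) α ξ)

/-- `R = ∑_{k=0}^r λ_k[u] T^k` is an `i`-symmetry driver. -/
def IsISymmetryDriver (r : ℕ) (lam : ℕ → E.Fun) : Prop :=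
  lam r ≠ 0 ∧ ∀ η : ℤ → E.Fun, IsNonautonomousFun η → Di η = 0 → IsSymmetry (opT (r + 1) lam η)

/-- `∑_{k=0}^m μ_k[u] T^k` is a formal `i`-integral:
`D ∑_{k=0}^m μ_k T^k = ∑_{k=0}^{m-1} ν_k[u] T^k L` as operators. -/
def IsFormalIIntegral (m : ℕ) (μ : ℕ → E.Fun) : Prop :=
  0 < m ∧ μ m ≠ 0 ∧ ∃ ν : ℕ → E.Fun, ∀ f : ℤ → E.Fun, IsNonautonomousFun f →
    Di (opT (m + 1) μ f) = opT m ν (L f)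

/-- `∑_{k=0}^n β_k[u] D^k` is a formal `x`-integral:
`(T - 1) ∑_{k=0}^n β_k D^k = ∑_{k=0}^{n-1} γ_k[u] D^k L` as operators. -/
def IsFormalXIntegral (n : ℕ) (β : ℕ → E.Fun) : Prop :=
  0 < n ∧ β n ≠ 0 ∧ ∃ γ : ℕ → E.Fun, ∀ f : ℤ → E.Fun, IsNonautonomousFun f →
    Ti (opD (n + 1) β f) - opD (n + 1) β f = opD n γ (L f)

end Equation

end SemiDiscrete

namespace SemiDiscrete

/-! On the field K of functions, T is an automorphism commuting with the derivation D. Write L = φ -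
ψ with φ = TD - bT and ψ = aD + c, where a, b, c are the partial derivatives of F. All four objects
of the theorem turn into finite chains of elements of K. If Dη = 0, then L(r_k T^k η) = φ(r_k)
T^{k+1}η - ψ(r_k) T^k η. So ∑ r_k T^k is an i-symmetry driver exactly when ψ(r_0) = 0 and φ(r_k) =
ψ(r_{k+1}): this is `ChainR`. If Tξ = ξ, the same computation with D^k gives `ChainS`, linking T - a
and -L. Formal integrals factor: with N = ∑ T^k n_k and Γ = ∑ D^k s_k (coefficients acting first),
an i-integral is N(T - a) with D N (T - a) = N L, and an x-integral is Γψ with TΓψ = Γφ. These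
identities say that n and s are an R-chain and an S-chain of the formal adjoint of L. Delta
sequences in i and an x with Dx = 1, Tx = x allow the comparison of coefficients. It remains to pass
between L and its adjoint (`chains_iff_adjoint`); since the adjoint is an involution, one direction
suffices. Take the R-chain. The adjoint R-chain makes L f = 0 solvable in sequences with prescribed
first term: solve N(T - a) f = δ, a triangular system; then N(L f) = D δ = 0 forces L f = 0. This
yields arbitrarily long chains which start with φ(g_0) = 0 but need not terminate. The adjoint
S-chain gives a linear ODE Γψ e = 0 for the last element of every chain starting from 0. These
elements form increasing groups closed under multiplication by constants, and a Wronskian argument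
(`exists_le_of_jets`) makes them stabilise. A long chain can then be corrected by a chain starting
from 0 with the same last element, and the difference terminates (`finChain_of_stable`). For the
S-chain the two hypotheses exchange roles, and the Wronskian becomes a Casoratian. -/

/-- A finite chain linking two operators: a nonzero finite sequence `r` with
`ψ (r 0) = 0` and `φ (r k) = ψ (r (k + 1))`. -/
def FinChain {K : Type*} [AddCommGroup K] (φ ψ : K → K) : Prop :=
  ∃ r : ℕ → K, (∃ n, r n ≠ 0 ∧ ∀ k, n < k → r k = 0) ∧ ψ (r 0) = 0 ∧
    ∀ k, φ (r k) = ψ (r (k + 1))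

theorem end_pow_succ {M : Type*} [AddCommMonoid M] (f : AddMonoid.End M) (k : ℕ) (m : M) :
    (f ^ (k + 1)) m = (f ^ k) (f m) := by
  rw [pow_succ]; rfl

theorem end_pow_succ' {M : Type*} [AddCommMonoid M] (f : AddMonoid.End M) (k : ℕ) (m : M) :
    (f ^ (k + 1)) m = f ((f ^ k) m) := by
  rw [pow_succ']; rfl

theorem exists_top {K : Type*} [Zero K] {r : ℕ → K} {P : ℕ} (hP : ∀ k, P ≤ k → r k = 0)
    (hr : ∃ k, r k ≠ 0) : ∃ n, n < P ∧ r n ≠ 0 ∧ ∀ k, n < k → r k = 0 := by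
  classical
  obtain ⟨k, hk⟩ := hr
  have hkP : k ≤ P := by
    by_contra h
    exact hk (hP k (by omega))
  have h1 := Nat.findGreatest_spec (P := fun k => r k ≠ 0) hkP hk
  refine ⟨Nat.findGreatest (fun k => r k ≠ 0) P, ?_, h1, fun j hj => ?_⟩
  · refine lt_of_le_of_ne (Nat.findGreatest_le P) fun h => h1 ?_
    rw [h]
    exact hP P le_rfl
  · by_contra h
    by_cases hjP : j ≤ P
    · exact Nat.findGreatest_is_greatest hj hjP h
    · exact h (hP j (by omega))

/-! ### Algebra of the operator L, its adjoint and its representations -/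

/-- A field with commuting automorphism `T` and derivation `D`, and the coefficients of the
operator `T D - a D - b T - c`. -/
@[ext]
structure LinData (K : Type*) [Field K] where
  T : K ≃+* K
  D : K →+ K
  leibniz : ∀ f g, D (f * g) = D f * g + f * D g
  comm : ∀ f, T (D f) = D (T f)
  a : K
  b : K
  c : K
  a_ne : a ≠ 0

namespace LinData

variable {K : Type*} [Field K] (d : LinData K)

theorem D_one : d.D 1 = 0 := by
  have := d.leibniz 1 1
  simpa using this

theorem symm_comm (f : K) : d.T.symm (d.D f) = d.D (d.T.symm f) := by
  apply d.T.injective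
  rw [d.comm]
  simp

/-- The formally adjoint operator, written in the same form. -/
def adjoint : LinData K where
  T := d.T.symm
  D := -d.D
  leibniz f g := by
    simp only [AddMonoidHom.neg_apply, d.leibniz]
    ring
  comm f := by simp [d.symm_comm]
  a := d.a
  b := d.T.symm d.b
  c := d.c - d.D d.a
  a_ne := d.a_ne

theorem adjoint_adjoint : d.adjoint.adjoint = d := by
  ext <;> simp [adjoint]

/-- The splitting of L is by powers of T. If Dk = 0, then φ(ke) = T(k) φ(e) and ψ(ke) = k ψ(e),
which makes chains compatible with constants. -/
def phi (e : K) : K := d.T (d.D e) - d.b * d.T e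
def psi (e : K) : K := d.a * d.D e + d.c * e
def shiftSub (e : K) : K := d.T e - d.a * e
def lin (e : K) : K := d.phi e - d.psi e

/-- The condition for ∑ r_k T^k to send ker D into ker L. The next definition is its analogue for ∑
s_k D^k and ker(T - 1). -/
def ChainR : Prop := FinChain d.phi d.psi
def ChainS : Prop := FinChain d.shiftSub fun e => -d.lin e

/-- A space on which `K`, `T` and `D` act compatibly. -/
structure Rep (M : Type*) [AddCommGroup M] [Module K M] where
  t : AddMonoid.End M
  dd : AddMonoid.End M
  t_smul : ∀ (k : K) (m : M), t (k • m) = d.T k • t m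
  d_smul : ∀ (k : K) (m : M), dd (k • m) = d.D k • m + k • dd m
  comm : ∀ m, t (dd m) = dd (t m)

namespace Rep

variable {d} {M : Type*} [AddCommGroup M] [Module K M] (V : d.Rep M)

/-- `T D - b T` -/
def phi (m : M) : M := V.t (V.dd m) - d.b • V.t m
/-- `a D + c` -/
def psi (m : M) : M := d.a • V.dd m + d.c • m
/-- `T - a` -/
def shiftSub (m : M) : M := V.t m - d.a • m
/-- `T D - a D - b T - c` -/
def lin (m : M) : M := V.phi m - V.psi m

theorem t_pow_dd (k : ℕ) (m : M) : (V.t ^ k) (V.dd m) = V.dd ((V.t ^ k) m) := by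
  induction k generalizing m with
  | zero => rfl
  | succ k ih => rw [end_pow_succ, V.comm, ih]; rfl

theorem dd_pow_t (k : ℕ) (m : M) : V.t ((V.dd ^ k) m) = (V.dd ^ k) (V.t m) := by
  induction k generalizing m with
  | zero => rfl
  | succ k ih => rw [end_pow_succ, ih, V.comm]; rfl

theorem t_pow_smul (j : ℕ) (k : K) (m : M) :
    (V.t ^ j) (k • m) = (d.T^[j] k) • (V.t ^ j) m := by
  induction j generalizing k m with
  | zero => rfl
  | succ j ih => rw [end_pow_succ, V.t_smul, ih]; rfl

/-- `∑_{k < P} T^k ∘ n_k` -/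
def sumT (P : ℕ) (n : ℕ → K) (m : M) : M := ∑ k ∈ Finset.range P, (V.t ^ k) (n k • m)
/-- `∑_{k < P} D^k ∘ s_k` -/
def sumD (P : ℕ) (s : ℕ → K) (m : M) : M := ∑ k ∈ Finset.range P, (V.dd ^ k) (s k • m)

/-- A finite chain for the adjoint operator gives `D N (T - a) = N L` with `N = ∑ T^k ∘ n_k`. -/
theorem dd_sumT {n : ℕ → K} {P : ℕ} (hP : n P = 0) (h0 : d.adjoint.psi (n 0) = 0)
    (hn : ∀ k, d.adjoint.phi (n k) = d.adjoint.psi (n (k + 1))) (m : M) :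
    V.dd (V.sumT P n (V.shiftSub m)) = V.sumT P n (V.lin m) := by
  -- The chain relation trades the adjoint φ of `n k` for the adjoint ψ of `n (k + 1)`, so each term
  -- becomes a difference and the sum telescopes.
  have key : ∀ k, V.dd ((V.t ^ k) (n k • V.shiftSub m)) - (V.t ^ k) (n k • V.lin m) =
      -((V.t ^ (k + 1)) (d.adjoint.psi (n (k + 1)) • m) -
        (V.t ^ k) (d.adjoint.psi (n k) • m)) := by
    intro k
    rw [← V.t_pow_dd, ← hn, end_pow_succ, ← map_sub, ← map_sub, ← map_neg]
    congr 1
    simp only [V.t_smul, V.d_smul, shiftSub, lin, Rep.phi, Rep.psi, LinData.phi, LinData.psi,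
      adjoint, map_sub, map_mul, AddMonoidHom.neg_apply, map_neg, V.comm]
    simp only [RingEquiv.apply_symm_apply, sub_smul, smul_sub, smul_add, add_smul, mul_smul,
      neg_smul]
    module
  rw [← sub_eq_zero, sumT, sumT, map_sum, ← Finset.sum_sub_distrib, Finset.sum_congr rfl
    (fun k _ => key k), Finset.sum_neg_distrib,
    Finset.sum_range_sub fun k => (V.t ^ k) (d.adjoint.psi (n k) • m), hP, h0]
  simp [LinData.psi]

/-- Both sides are D^k applied to an element. Moving the outer D past the coefficient of T m leaves
exactly the adjoint operators on s, so summing over k compares the coefficients of consecutive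
powers of D. -/
theorem t_dd_pow_psi_sub (k : ℕ) (s : K) (m : M) :
    V.t ((V.dd ^ k) (s • V.psi m)) - (V.dd ^ k) (s • V.phi m) =
      (V.dd ^ (k + 1)) (-d.T (d.adjoint.shiftSub s) • V.t m) +
        (V.dd ^ k) (-d.T (d.adjoint.lin s) • V.t m) := by
  rw [V.dd_pow_t, end_pow_succ, ← map_sub, ← map_add]
  congr 1
  simp only [V.t_smul, V.d_smul, LinData.shiftSub, LinData.lin, Rep.phi, Rep.psi, LinData.phi,
    LinData.psi, adjoint, map_sub, map_add, map_mul, AddMonoidHom.neg_apply, map_neg, V.comm,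
    d.leibniz, d.comm, RingEquiv.apply_symm_apply]
  simp only [sub_smul, smul_sub, smul_add, add_smul, mul_smul, neg_smul]
  module

/-- A finite chain for the adjoint operator gives `T Γ ψ = Γ φ` with `Γ = ∑ D^k ∘ s_k`. -/
theorem t_sumD {s : ℕ → K} {P : ℕ} (hP : s P = 0) (h0 : -d.adjoint.lin (s 0) = 0)
    (hs : ∀ k, d.adjoint.shiftSub (s k) = -d.adjoint.lin (s (k + 1))) (m : M) :
    V.t (V.sumD P s (V.psi m)) = V.sumD P s (V.phi m) := by
  have key : ∀ k, V.t ((V.dd ^ k) (s k • V.psi m)) - (V.dd ^ k) (s k • V.phi m) =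
      (V.dd ^ (k + 1)) (d.T (d.adjoint.lin (s (k + 1))) • V.t m) -
        (V.dd ^ k) (d.T (d.adjoint.lin (s k)) • V.t m) := by
    intro k
    rw [t_dd_pow_psi_sub, hs, map_neg, neg_neg, neg_smul, map_neg, sub_eq_add_neg]
  rw [← sub_eq_zero, sumD, sumD, map_sum, ← Finset.sum_sub_distrib, Finset.sum_congr rfl
    (fun k _ => key k),
    Finset.sum_range_sub fun k => (V.dd ^ k) (d.T (d.adjoint.lin (s k)) • V.t m), hP,
    neg_eq_zero.1 h0]
  simp [LinData.lin, LinData.psi, LinData.phi]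

end Rep

/-- `K` itself. -/
def base : d.Rep K where
  t := d.T.toAddMonoidHom
  dd := d.D
  t_smul k m := map_mul d.T k m
  d_smul := d.leibniz
  comm := d.comm

/-- Sequences, with `T` also shifting the index. -/
def seqT : d.Rep (ℤ → K) where
  t := { toFun := fun f i => d.T (f (i + 1))
         map_zero' := by ext; simp
         map_add' := fun f g => by ext; simp }
  dd := { toFun := fun f i => d.D (f i)
          map_zero' := by ext; simp
          map_add' := fun f g => by ext; simp }
  t_smul k m := by ext i; exact map_mul d.T k _
  d_smul k m := by ext i; exact d.leibniz k _
  comm m := by ext i; exact d.comm _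

/-- Sequences, with `D` also involving the shift of the index. -/
def seqD : d.Rep (ℤ → K) where
  t := { toFun := fun f i => d.T (f i)
         map_zero' := by ext; simp
         map_add' := fun f g => by ext; simp }
  dd := { toFun := fun f i => d.D (f i) + f (i + 1)
          map_zero' := by ext; simp
          map_add' := fun f g => by ext; simp; ring }
  t_smul k m := by ext i; exact map_mul d.T k _
  d_smul k m := by
    ext i
    show d.D (k * m i) + k * m (i + 1) = d.D k * m i + k * (d.D (m i) + m (i + 1))
    rw [d.leibniz]; ring
  comm m := by
    ext i
    show d.T (d.D (m i) + m (i + 1)) = d.D (d.T (m i)) + d.T (m (i + 1))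
    rw [map_add, d.comm]

end LinData

/-! ### Long chains, stabilisation and finite chains -/

section Chains

variable {K : Type*}

/-- The last elements of the chains `0, t 1, …, t j` with `φ (t (i + 1)) = ψ (t i)`. -/
def chainGroup [AddCommGroup K] (φ ψ : K →+ K) : ℕ → AddSubgroup K
  | 0 => ⊥
  | j + 1 => ((chainGroup φ ψ j).map ψ).comap φ

theorem mem_chainGroup_succ [AddCommGroup K] {φ ψ : K →+ K} {j : ℕ} {e : K} :
    e ∈ chainGroup φ ψ (j + 1) ↔ ∃ e' ∈ chainGroup φ ψ j, ψ e' = φ e := by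
  simp [chainGroup]

theorem chainGroup_le_succ [AddCommGroup K] (φ ψ : K →+ K) (j : ℕ) :
    chainGroup φ ψ j ≤ chainGroup φ ψ (j + 1) := by
  induction j with
  | zero => exact bot_le
  | succ j ih => exact AddSubgroup.comap_mono (AddSubgroup.map_mono ih)

theorem chainGroup_mono [AddCommGroup K] (φ ψ : K →+ K) : Monotone (chainGroup φ ψ) :=
  monotone_nat_of_le_succ (chainGroup_le_succ φ ψ)

theorem exists_chain_of_mem_chainGroup [AddCommGroup K] {φ ψ : K →+ K} {j : ℕ} {e : K}
    (he : e ∈ chainGroup φ ψ j) :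
    ∃ t : ℕ → K, t 0 = 0 ∧ t j = e ∧ ∀ i < j, φ (t (i + 1)) = ψ (t i) := by
  induction j generalizing e with
  | zero => exact ⟨0, rfl, (AddSubgroup.mem_bot.1 he).symm, by simp⟩
  | succ j ih =>
    obtain ⟨e', he', h⟩ := mem_chainGroup_succ.1 he
    obtain ⟨t, h0, hj, ht⟩ := ih he'
    refine ⟨Function.update t (j + 1) e, by simpa using h0, by simp, fun i hi => ?_⟩
    rcases Nat.lt_succ_iff_lt_or_eq.1 hi with hi | rfl
    · rw [Function.update_of_ne (by omega), Function.update_of_ne (by omega), ht i hi]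
    · rw [Function.update_self, Function.update_of_ne (by omega), hj, h]

/-- If long chains exist and their possible last elements stabilise, a finite chain exists. -/
theorem finChain_of_stable [AddCommGroup K] (φ ψ : K →+ K)
    (hlong : ∀ J : ℕ, ∃ g : ℕ → K, g 0 ≠ 0 ∧ φ (g 0) = 0 ∧ ∀ i < J, φ (g (i + 1)) = ψ (g i))
    (hst : ∃ j, chainGroup φ ψ (j + 1) ≤ chainGroup φ ψ j) : FinChain φ ψ := by
  obtain ⟨j, hj⟩ := hst
  obtain ⟨g, g0, hg0, hg⟩ := hlong j
  have hmem : ∀ i ≤ j, g i ∈ chainGroup φ ψ (i + 1) := by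
    intro i
    induction i with
    | zero => exact fun _ => mem_chainGroup_succ.2 ⟨0, zero_mem _, by simp [hg0]⟩
    | succ i ih =>
      exact fun h => mem_chainGroup_succ.2 ⟨g i, ih (by omega), (hg i (by omega)).symm⟩
  -- The long chain, preceded by 0, has j + 1 steps up to `g j`. Stability gives a chain from 0
  -- reaching the same element in j steps, so that subtracting it index by index keeps `g 0` and
  -- kills the entry j.
  obtain ⟨t, t0, tj, ht⟩ := exists_chain_of_mem_chainGroup (hj (hmem j le_rfl))
  obtain ⟨h, hh⟩ : ∃ h : ℕ → K, h = fun i => g i - t i := ⟨_, rfl⟩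
  have h0 : h 0 ≠ 0 := by simpa [hh, t0] using g0
  have hφ0 : φ (h 0) = 0 := by simp [hh, t0, hg0]
  have hjz : h j = 0 := by simp [hh, tj]
  have hstep : ∀ i < j, φ (h (i + 1)) = ψ (h i) := fun i hi => by
    simp [hh, hg i hi, ht i hi]
  obtain ⟨q, rfl⟩ : ∃ q, j = q + 1 := by
    cases j with
    | zero => exact absurd hjz h0
    | succ q => exact ⟨q, rfl⟩
  -- The difference is read backwards: `h (q + 1) = 0` gives the initial condition on ψ, and `φ (h
  -- 0) = 0` lets the chain be continued by zeros.
  refine ⟨fun k => if k ≤ q then h (q - k) else 0, ⟨q, by simpa using h0, fun k hk => ?_⟩, ?_,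
    fun k => ?_⟩
  · exact if_neg (by omega)
  · simp only [Nat.zero_le, if_true, Nat.sub_zero]
    rw [← hstep q (by omega), hjz, map_zero]
  · dsimp only
    rcases lt_trichotomy k q with hk | rfl | hk
    · rw [if_pos hk.le, if_pos (by omega), ← hstep _ (by omega)]
      congr 2
      omega
    · rw [if_pos le_rfl, if_neg (by omega), Nat.sub_self, hφ0, map_zero]
    · rw [if_neg (by omega), if_neg (by omega), map_zero, map_zero]

/-- An increasing sequence of groups of solutions, closed under multiplication by constants,
stabilises, if relations between `n`-jets of solutions may be differentiated. -/
theorem exists_le_of_jets [Field K] (A : ℕ → AddSubgroup K) (hA : Monotone A) (δ : K → K)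
    (hδ1 : δ 1 = 0) (hconst : ∀ k, δ k = 0 → ∀ j, ∀ e ∈ A j, k * e ∈ A j)
    (jet : ℕ → K → K) (hjet : ∀ e, jet 0 e = e) (n : ℕ) (hn : 0 < n)
    (hrel : ∀ (P : ℕ) (k e : ℕ → K), (∀ i, ∃ j, e i ∈ A j) →
      (∀ j < n, ∑ i ∈ Finset.range P, k i * jet j (e i) = 0) →
      ∀ j < n, ∑ i ∈ Finset.range P, δ (k i) * jet j (e i) = 0) :
    ∃ j, A (j + 1) ≤ A j := by
  classical
  by_contra! hno
  have : ∀ j, ∃ e, e ∈ A (j + 1) ∧ e ∉ A j := fun j => Set.not_subset.1 (hno j)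
  choose e he hne using this
  have normalize : ∀ (P : ℕ) (k : ℕ → K),
      (∀ j < n, ∑ i ∈ Finset.range P, k i * jet j (e i) = 0) → (∃ i < P, k i ≠ 0) →
      ∃ q < P, ∃ k' : ℕ → K, k' q = 1 ∧
        ∀ j < n, ∑ i ∈ Finset.range (q + 1), k' i * jet j (e i) = 0 := by
    intro P k hk hk0
    obtain ⟨i, hi, hki⟩ := hk0
    obtain ⟨q, hq, hq0, htop⟩ := exists_top (r := fun i => if i < P then k i else 0) (P := P)
      (fun i hi => if_neg (by omega)) ⟨i, by simpa [hi] using hki⟩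
    simp only [hq, if_true] at hq0
    refine ⟨q, hq, fun i => (k q)⁻¹ * k i, inv_mul_cancel₀ hq0, fun j hj => ?_⟩
    have h1 : ∑ i ∈ Finset.range (q + 1), k i * jet j (e i) = 0 := by
      rw [← hk j hj]
      refine Finset.sum_subset (Finset.range_mono (by omega)) fun i hi hi' => ?_
      rw [Finset.mem_range] at hi hi'
      have := htop i (by omega)
      rw [if_pos hi] at this
      rw [this, zero_mul]
    simp only [mul_assoc]
    rw [← Finset.mul_sum, h1, mul_zero]
  -- There are n + 1 jets in an n-dimensional space; a dependence is cut off at its last nonzero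
  -- coefficient, scaled to 1.
  have hex : ∃ q, ∃ k' : ℕ → K, k' q = 1 ∧
      ∀ j < n, ∑ i ∈ Finset.range (q + 1), k' i * jet j (e i) = 0 := by
    have hdep : ¬ LinearIndependent K
        (fun i : Fin (n + 1) => fun j : Fin n => jet j (e i)) := by
      intro h
      have := h.fintype_card_le_finrank
      simp at this
    obtain ⟨g, hg, i, hi⟩ := Fintype.not_linearIndependent_iff.1 hdep
    obtain ⟨q, -, h⟩ := normalize (n + 1) (fun i => if h : i < n + 1 then g ⟨i, h⟩ else 0)
      (fun j hj => by
        have := congrFun hg ⟨j, hj⟩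
        rw [Finset.sum_apply] at this
        rw [Finset.sum_range]
        simpa [Fin.is_le] using this) ⟨i, i.2, by simpa [Fin.is_le] using hi⟩
    exact ⟨q, h⟩
  obtain ⟨k, hk1, hk⟩ := Nat.find_spec hex
  have hmin := fun q => Nat.find_min hex (m := q)
  generalize Nat.find hex = p at hk1 hk hmin
  -- Applying δ to the shortest relation kills its leading coefficient 1, so a nonzero `δ (k i)`
  -- would give a shorter relation.
  have hδ : ∀ i < p, δ (k i) = 0 := by
    by_contra! hc
    have h2 := hrel (p + 1) k e (fun i => ⟨_, he i⟩) hk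
    obtain ⟨q, hq, h⟩ := normalize p (fun i => δ (k i)) (fun j hj => by
      have := h2 j hj
      rwa [Finset.sum_range_succ, hk1, hδ1, zero_mul, add_zero] at this) hc
    exact hmin q hq h
  -- The zeroth jet now expresses `e p` through earlier `e i`, which all lie in `A p`, with constant
  -- coefficients. This contradicts the choice of `e p`.
  have h3 := hk 0 hn
  simp only [hjet, Finset.sum_range_succ, hk1, one_mul] at h3
  refine hne p ?_
  rw [← neg_mem_iff, ← eq_neg_of_add_eq_zero_left h3]
  exact sum_mem fun i hi => hconst _ (hδ i (Finset.mem_range.1 hi)) _ _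
    (hA (Finset.mem_range.1 hi) (he i))

end Chains

/-! ### Triangular operators on sequences -/

section Order

variable {K : Type*} [Field K]

/-- `Y` is an operator on sequences with `Y f j` depending on `f i`, `i ≤ j + n`, the dependence
on the last one being through `τ`. -/
def HasOrd (Y : (ℤ → K) → ℤ → K) (n : ℕ) (τ : K → K) : Prop :=
  ∀ (f : ℤ → K) (j : ℤ), (∀ i < j + n, f i = 0) → Y f j = τ (f (j + n))

theorem HasOrd.comp {Y Z : (ℤ → K) → ℤ → K} {m n : ℕ} {τ ρ : K → K} (hY : HasOrd Y m τ)
    (hZ : HasOrd Z n ρ) (hρ : ρ 0 = 0) :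
    HasOrd (fun f => Y (Z f)) (m + n) (fun e => τ (ρ e)) := by
  intro f j hf
  push_cast at hf ⊢
  rw [hY, hZ, add_assoc]
  · exact fun i hi => hf i (by omega)
  · intro i hi
    rw [hZ _ _ fun l hl => hf l (by omega), hf _ (by omega), hρ]

/-- The equation at j determines a condition on `f (j + n)` alone once the earlier values are fixed,
and τ is onto. Changing that value does not disturb earlier equations. -/
theorem HasOrd.exists_solution {Y : (ℤ → K) → ℤ → K} (hadd : ∀ f g, Y (f + g) = Y f + Y g)
    {n : ℕ} {τ : K → K} (hY : HasOrd Y n τ) (hτ : Function.Surjective τ) (hτ0 : τ 0 = 0)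
    (J : ℕ) :
    ∃ f : ℤ → K, (∀ i < 0, f i = 0) ∧ f 0 ≠ 0 ∧
      ∀ j < (J : ℤ), Y f j = if j = -n then 1 else 0 := by
  suffices h : ∀ J : ℕ, ∃ f : ℤ → K, (∀ i < 0, f i = 0) ∧ f 0 ≠ 0 ∧
      ∀ j < -(n : ℤ) + 1 + J, Y f j = if j = -n then 1 else 0 by
    obtain ⟨f, h0, h1, h2⟩ := h (J + n)
    exact ⟨f, h0, h1, fun j hj => h2 j (by push_cast; omega)⟩
  clear J
  intro J
  induction J with
  | zero =>
    obtain ⟨κ, hκ⟩ := hτ 1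
    refine ⟨Pi.single 0 κ, fun i hi => Pi.single_eq_of_ne (by omega) _, ?_, fun j hj => ?_⟩
    · rw [Pi.single_eq_same]
      rintro rfl
      exact zero_ne_one (hτ0.symm.trans hκ)
    · rw [hY _ _ fun i hi => Pi.single_eq_of_ne (by push_cast at hj; omega) _]
      split_ifs with h
      · rw [h, neg_add_cancel, Pi.single_eq_same, hκ]
      · rw [Pi.single_eq_of_ne (by omega), hτ0]
  | succ J ih =>
    obtain ⟨f, h0, h1, h2⟩ := ih
    obtain ⟨κ, hκ⟩ := hτ (-Y f (-n + 1 + J))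
    -- The new entry sits at index 1 + J = (-n + 1 + J) + n, the last one seen by the next equation,
    -- and cancels the residue there.
    refine ⟨f + Pi.single (1 + (J : ℤ)) κ, fun i hi => ?_, ?_, fun j hj => ?_⟩
    · rw [Pi.add_apply, h0 i hi, Pi.single_eq_of_ne (by omega), zero_add]
    · rwa [Pi.add_apply, Pi.single_eq_of_ne (by omega), add_zero]
    · push_cast at hj
      rw [hadd, Pi.add_apply,
        hY (Pi.single _ _) j fun i hi => Pi.single_eq_of_ne (by omega) _]
      rcases (by omega : j < -n + 1 + J ∨ j = -n + 1 + J) with hj' | rfl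
      · rw [h2 j hj', Pi.single_eq_of_ne (by omega), hτ0, add_zero]
      · rw [show -(n : ℤ) + 1 + J + n = 1 + J by ring, Pi.single_eq_same, hκ, add_neg_cancel,
          if_neg (by omega)]

theorem HasOrd.eq_zero {Y : (ℤ → K) → ℤ → K} {n : ℕ} {τ : K → K} (hY : HasOrd Y n τ)
    (hτ : ∀ e, τ e = 0 → e = 0) {w : ℤ → K} {N J : ℤ} (hw : ∀ i < N, w i = 0)
    (hJ : ∀ j < J, Y w j = 0) : ∀ i < J + n, w i = 0 := by
  suffices h : ∀ m : ℕ, ∀ i < N + m, i < J + n → w i = 0 from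
    fun i hi => h (i - N + 1).toNat i (by omega) hi
  intro m
  induction m with
  | zero => exact fun i hi _ => hw i (by simpa using hi)
  | succ m ih =>
    intro i hi hi'
    push_cast at hi
    refine hτ _ ?_
    have := hY w (i - n) fun l hl => ih l (by omega) (by omega)
    rw [hJ _ (by omega)] at this
    rw [this, sub_add_cancel]

end Order

/-! ### Passing from the adjoint operator to the operator -/

namespace LinData

universe u

variable {K : Type u} [Field K] (d : LinData K)

/-- The coefficients are chosen before the representation, so that one set serves both for K and for
sequences. -/
theorem exists_left_coeff_single (k : ℕ) (s : K) : ∃ γ : ℕ → K, γ k = s ∧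
    ∀ (M : Type u) [AddCommGroup M] [Module K M] (V : d.Rep M) (m : M),
      (V.dd ^ k) (s • m) = ∑ j ∈ Finset.range (k + 1), γ j • (V.dd ^ j) m := by
  induction k with
  | zero => exact ⟨fun _ => s, rfl, fun M _ _ V m => by simp⟩
  | succ k ih =>
    obtain ⟨γ, hγ, h⟩ := ih
    refine ⟨fun j => (if j = k + 1 then 0 else d.D (γ j)) + if j = 0 then 0 else γ (j - 1),
      by simp [hγ], fun M _ _ V m => ?_⟩
    rw [end_pow_succ', h, map_sum]
    simp only [V.d_smul, ← end_pow_succ', Finset.sum_add_distrib, add_smul]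
    congr 1
    · rw [Finset.sum_range_succ (n := k + 1), if_pos rfl, zero_smul, add_zero]
      refine Finset.sum_congr rfl fun j hj => ?_
      rw [if_neg (Finset.mem_range.1 hj).ne]
    · rw [Finset.sum_range_succ' (n := k + 1)]
      simp

/-- Operators `∑ D^k ∘ s_k` can be rewritten with the coefficients on the left. -/
theorem exists_left_coeff (n : ℕ) (s : ℕ → K) : ∃ γ : ℕ → K, γ n = s n ∧
    ∀ (M : Type u) [AddCommGroup M] [Module K M] (V : d.Rep M) (m : M),
      V.sumD (n + 1) s m = ∑ j ∈ Finset.range (n + 1), γ j • (V.dd ^ j) m := by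
  induction n with
  | zero => exact ⟨s, rfl, fun M _ _ V m => by simp [Rep.sumD]⟩
  | succ n ih =>
    obtain ⟨γ, hγ, h⟩ := ih
    obtain ⟨ρ, hρ, h'⟩ := d.exists_left_coeff_single (n + 1) (s (n + 1))
    refine ⟨fun j => (if j = n + 1 then 0 else γ j) + ρ j, by simp [hρ], fun M _ _ V m => ?_⟩
    have h1 := h M V m
    simp only [Rep.sumD] at h1 ⊢
    rw [Finset.sum_range_succ, h1, h' M V m]
    simp only [Finset.sum_add_distrib, add_smul]
    congr 1
    rw [Finset.sum_range_succ (n := n + 1), if_pos rfl, zero_smul, add_zero]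
    refine Finset.sum_congr rfl fun j hj => ?_
    rw [if_neg (Finset.mem_range.1 hj).ne]

namespace Rep

variable {d} {M : Type*} [AddCommGroup M] [Module K M] (V : d.Rep M)

theorem sumT_add (P : ℕ) (n : ℕ → K) (x y : M) :
    V.sumT P n (x + y) = V.sumT P n x + V.sumT P n y := by
  simp [sumT, Finset.sum_add_distrib]

theorem sumD_add (P : ℕ) (n : ℕ → K) (x y : M) :
    V.sumD P n (x + y) = V.sumD P n x + V.sumD P n y := by
  simp [sumD, Finset.sum_add_distrib]

theorem shiftSub_add (x y : M) : V.shiftSub (x + y) = V.shiftSub x + V.shiftSub y := by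
  simp only [shiftSub, map_add, smul_add]; abel

theorem psi_add (x y : M) : V.psi (x + y) = V.psi x + V.psi y := by
  simp only [psi, map_add, smul_add]; abel

theorem phi_add (x y : M) : V.phi (x + y) = V.phi x + V.phi y := by
  simp only [phi, map_add, smul_add]; abel

theorem lin_add (x y : M) : V.lin (x + y) = V.lin x + V.lin y := by
  simp only [lin, phi_add, psi_add]; abel

theorem lin_add_psi (m : M) : V.lin m + V.psi m = V.phi m := sub_add_cancel _ _

/-- A finite chain for the adjoint operator gives `(T - 1) Γ ψ = Γ L` with `Γ = ∑ D^k ∘ s_k`. -/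
theorem t_sumD_sub {s : ℕ → K} {P : ℕ} (hP : s P = 0) (h0 : -d.adjoint.lin (s 0) = 0)
    (hs : ∀ k, d.adjoint.shiftSub (s k) = -d.adjoint.lin (s (k + 1))) (m : M) :
    V.t (V.sumD P s (V.psi m)) - V.sumD P s (V.psi m) = V.sumD P s (V.lin m) := by
  rw [V.t_sumD hP h0 hs, ← V.lin_add_psi, V.sumD_add, add_sub_cancel_right]

/-- The coefficients of `Γ ∘ ψ` for `Γ = ∑ D^k ∘ s_k`. -/
theorem sumD_psi {s : ℕ → K} {P : ℕ} (hP : s P = 0) (m : M) :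
    V.sumD P s (V.psi m) = V.sumD (P + 1)
      (fun k => (if k = 0 then 0 else s (k - 1) * d.a) + (s k * d.c - d.D (s k * d.a))) m := by
  have key : ∀ k, (V.dd ^ k) (s k • V.psi m) = (V.dd ^ (k + 1)) ((s k * d.a) • m) +
      (V.dd ^ k) ((s k * d.c - d.D (s k * d.a)) • m) := by
    intro k
    rw [end_pow_succ, ← map_add, V.d_smul, psi]
    congr 1
    module
  simp only [sumD, key, add_smul, map_add, Finset.sum_add_distrib]
  congr 1
  · rw [Finset.sum_range_succ' (n := P)]
    simp
  · rw [Finset.sum_range_succ (n := P)]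
    simp [hP]

end Rep

/-- The form of `Γ ∘ ψ` with the coefficients on the left. -/
theorem exists_left_coeff_sumD_psi {s : ℕ → K} {p : ℕ} (hp : s p ≠ 0) (hsP : s (p + 1) = 0) :
    ∃ β : ℕ → K, β (p + 1) ≠ 0 ∧
      ∀ (M : Type u) [AddCommGroup M] [Module K M] (V : d.Rep M) (m : M),
        V.sumD (p + 1) s (V.psi m) = ∑ j ∈ Finset.range (p + 2), β j • (V.dd ^ j) m := by
  obtain ⟨β, hβ, hβs⟩ := d.exists_left_coeff (p + 1)
    fun k => (if k = 0 then 0 else s (k - 1) * d.a) + (s k * d.c - d.D (s k * d.a))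
  refine ⟨β, ?_, fun M _ _ V m => by rw [V.sumD_psi hsP, hβs]⟩
  rw [hβ]
  simpa [hsP] using ⟨hp, d.a_ne⟩

theorem seqT_t_pow (k : ℕ) (f : ℤ → K) (i : ℤ) : (d.seqT.t ^ k) f i = d.T^[k] (f (i + k)) := by
  induction k generalizing f with
  | zero => simp
  | succ k ih =>
    rw [end_pow_succ, ih]
    show d.T^[k] (d.T (f (i + k + 1))) = _
    rw [← Function.iterate_succ_apply, add_assoc]
    push_cast
    rfl

theorem iterate_T_zero (k : ℕ) : d.T^[k] 0 = 0 := iterate_map_zero d.T k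

theorem iterate_T_bijective (k : ℕ) : Function.Bijective d.T^[k] := d.T.bijective.iterate k

theorem hasOrd_seqT_sumT (p : ℕ) (n : ℕ → K) :
    HasOrd (d.seqT.sumT (p + 1) n) p fun e => d.T^[p] (n p * e) := by
  intro f j hf
  rw [Rep.sumT, Finset.sum_apply, Finset.sum_range_succ, Finset.sum_eq_zero, zero_add,
    seqT_t_pow]
  · rfl
  · intro k hk
    rw [Finset.mem_range] at hk
    rw [seqT_t_pow, Pi.smul_apply, hf _ (by omega), smul_zero, iterate_T_zero]

theorem hasOrd_seqT_shiftSub : HasOrd d.seqT.shiftSub 1 d.T := by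
  intro f j hf
  show d.T (f (j + 1)) - d.a * f j = _
  rw [hf j (by omega), mul_zero, sub_zero]
  rfl

theorem hasOrd_seqD_dd_pow (k : ℕ) : HasOrd (d.seqD.dd ^ k : AddMonoid.End (ℤ → K)) k id := by
  induction k with
  | zero => intro f j _; simp
  | succ k ih =>
    have h1 : HasOrd d.seqD.dd 1 id := by
      intro f j hf
      show d.D (f j) + f (j + 1) = f (j + 1)
      rw [hf j (by omega), map_zero, zero_add]
    intro f j hf
    rw [end_pow_succ]
    exact ih.comp h1 rfl f j hf

theorem hasOrd_seqD_sumD (p : ℕ) (s : ℕ → K) :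
    HasOrd (d.seqD.sumD (p + 1) s) p fun e => s p * e := by
  intro f j hf
  rw [Rep.sumD, Finset.sum_apply, Finset.sum_range_succ, Finset.sum_eq_zero, zero_add]
  · exact hasOrd_seqD_dd_pow d p (s p • f) j fun i hi => by simp [hf i hi]
  · intro k hk
    rw [Finset.mem_range] at hk
    rw [hasOrd_seqD_dd_pow d k (s k • f) j fun i hi => by simp [hf i (by omega)]]
    simp [hf (j + k) (by omega)]

theorem hasOrd_seqD_psi : HasOrd d.seqD.psi 1 fun e => d.a * e := by
  intro f j hf
  show d.a * (d.D (f j) + f (j + 1)) + d.c * f j = _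
  rw [hf j (by omega), mul_zero, map_zero, zero_add, add_zero]
  rfl

theorem phi_add (x y : K) : d.phi (x + y) = d.phi x + d.phi y := d.base.phi_add x y
theorem psi_add (x y : K) : d.psi (x + y) = d.psi x + d.psi y := d.base.psi_add x y
theorem shiftSub_add (x y : K) : d.shiftSub (x + y) = d.shiftSub x + d.shiftSub y :=
  d.base.shiftSub_add x y
theorem neg_lin_add (x y : K) : -d.lin (x + y) = -d.lin x + -d.lin y := by
  rw [show d.lin (x + y) = d.lin x + d.lin y from d.base.lin_add x y, neg_add]

theorem phi_zero : d.phi 0 = 0 := by simp [phi]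
theorem psi_zero : d.psi 0 = 0 := by simp [psi]
theorem lin_zero : d.lin 0 = 0 := by simp [lin, phi, psi]

/-- Arbitrarily long chains, from a finite chain of the adjoint operator. -/
theorem exists_long_chainR (h : d.adjoint.ChainR) (J : ℕ) :
    ∃ g : ℕ → K, g 0 ≠ 0 ∧ d.phi (g 0) = 0 ∧ ∀ i < J, d.phi (g (i + 1)) = d.psi (g i) := by
  obtain ⟨n, ⟨p, hp, htop⟩, h0, hn⟩ := h
  have hord := (d.hasOrd_seqT_sumT p n).comp d.hasOrd_seqT_shiftSub (map_zero d.T)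
  obtain ⟨f, hf, hf0, hY⟩ := hord.exists_solution
    (fun f g => by simp only [Rep.shiftSub_add, Rep.sumT_add])
    ((d.iterate_T_bijective p).surjective.comp
      ((mul_left_surjective₀ hp).comp d.T.surjective)) (by simp) J
  -- The right-hand side δ takes only the values 0 and 1, which D annihilates, so N(L f) = 0. As
  -- `lin f i` involves only `f i` and `f (i + 1)`, it vanishes for i < -1, and the injective
  -- leading term of N propagates this upwards.
  have hlin : ∀ i < (J : ℤ) + p, d.seqT.lin f i = 0 := by
    refine (d.hasOrd_seqT_sumT p n).eq_zero (fun e he => ?_) (N := -1) (fun i hi => ?_)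
      fun j hj => ?_
    · have := (d.iterate_T_bijective p).injective (he.trans (d.iterate_T_zero p).symm)
      exact (mul_eq_zero.1 this).resolve_left hp
    · show d.phi (f (i + 1)) - d.psi (f i) = 0
      rw [hf _ (by omega), hf _ (by omega), phi_zero, psi_zero, sub_zero]
    · rw [← d.seqT.dd_sumT (htop (p + 1) (by omega)) h0 hn]
      show d.D (d.seqT.sumT (p + 1) n (d.seqT.shiftSub f) j) = 0
      rw [hY j hj]
      split_ifs
      exacts [d.D_one, map_zero _]
  have hstep : ∀ i < (J : ℤ), d.phi (f (i + 1)) = d.psi (f i) := fun i hi =>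
    sub_eq_zero.1 (hlin i (by omega))
  -- The equation at index -1, where `f (-1) = 0`, is the initial condition `phi (f 0) = 0`.
  refine ⟨fun i => f i, hf0, ?_, fun i hi => by exact_mod_cast hstep i (by exact_mod_cast hi)⟩
  have := hstep (-1) (by omega)
  rwa [hf (-1) (by omega), psi_zero] at this

/-- Arbitrarily long chains, from a finite chain of the adjoint operator. -/
theorem exists_long_chainS (h : d.adjoint.ChainS) (J : ℕ) :
    ∃ g : ℕ → K, g 0 ≠ 0 ∧ d.shiftSub (g 0) = 0 ∧
      ∀ i < J, d.shiftSub (g (i + 1)) = -d.lin (g i) := by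
  obtain ⟨s, ⟨p, hp, htop⟩, h0, hs⟩ := h
  have hord := (d.hasOrd_seqD_sumD p s).comp d.hasOrd_seqD_psi (mul_zero _)
  obtain ⟨f, hf, hf0, hY⟩ := hord.exists_solution
    (fun f g => by simp only [Rep.psi_add, Rep.sumD_add])
    ((mul_left_surjective₀ hp).comp (mul_left_surjective₀ d.a_ne)) (by simp) J
  -- A sequence f acts like a formal sum ∑ f_i z_i with T z_i = z_i and D z_{i+1} = z_i; hence the
  -- equation L f = 0 is precisely the S-chain relation.
  have hval : ∀ i, d.seqD.lin f i = d.lin (f i) + d.shiftSub (f (i + 1)) := by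
    intro i
    show d.T (d.D (f i) + f (i + 1)) - d.b * d.T (f i) -
      (d.a * (d.D (f i) + f (i + 1)) + d.c * f i) = _
    simp only [lin, phi, psi, shiftSub, map_add]
    ring
  have hlin : ∀ i < (J : ℤ) + p, d.seqD.lin f i = 0 := by
    refine (d.hasOrd_seqD_sumD p s).eq_zero (fun e he => ?_) (N := -1) (fun i hi => ?_)
      fun j hj => ?_
    · exact (mul_eq_zero.1 he).resolve_left hp
    · rw [hval, hf _ (by omega), hf _ (by omega), lin_zero]
      simp [shiftSub]
    -- Here T - 1 annihilates the right-hand side δ, since T does not shift the index in `seqD` and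
    -- fixes 0 and 1.
    · rw [← d.seqD.t_sumD_sub (htop (p + 1) (by omega)) h0 hs]
      show d.T (d.seqD.sumD (p + 1) s (d.seqD.psi f) j) - d.seqD.sumD (p + 1) s (d.seqD.psi f) j = 0
      rw [hY j hj]
      split_ifs <;> simp
  have hstep : ∀ i < (J : ℤ), d.shiftSub (f (i + 1)) = -d.lin (f i) := fun i hi => by
    rw [eq_neg_iff_add_eq_zero, add_comm, ← hval]
    exact hlin i (by omega)
  refine ⟨fun i => f i, hf0, ?_, fun i hi => by exact_mod_cast hstep i (by exact_mod_cast hi)⟩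
  have := hstep (-1) (by omega)
  rwa [hf (-1) (by omega), lin_zero, neg_zero] at this

/-- The adjoint R-chain produces long chains; the adjoint S-chain produces an ODE of order p + 1
that bounds the last elements of chains from 0. -/
theorem chainR_of_adjoint (hR : d.adjoint.ChainR) (hS : d.adjoint.ChainS) : d.ChainR := by
  let φ : K →+ K := AddMonoidHom.mk' d.phi d.phi_add
  let ψ : K →+ K := AddMonoidHom.mk' d.psi d.psi_add
  refine finChain_of_stable φ ψ (d.exists_long_chainR hR) ?_
  obtain ⟨s, ⟨p, hp, htop⟩, h0, hs⟩ := hS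
  have hsP := htop (p + 1) (by omega)
  -- Along a chain, T(Γψ e) = Γφ e = Γψ e', so the vanishing of Γψ passes from each element to the
  -- next.
  have hsol : ∀ j, ∀ e ∈ chainGroup φ ψ j, d.base.sumD (p + 1) s (d.psi e) = 0 := by
    intro j
    induction j with
    | zero =>
      intro e he
      rw [AddSubgroup.mem_bot.1 he, psi_zero]
      simp [Rep.sumD]
    | succ j ih =>
      intro e he
      obtain ⟨e', he', h⟩ := mem_chainGroup_succ.1 he
      have h1 := d.base.t_sumD hsP h0 hs e
      rw [show d.base.phi e = d.psi e' from h.symm, ih e' he'] at h1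
      exact d.T.injective (h1.trans (map_zero d.T).symm)
  obtain ⟨β, hβ0, hβs⟩ := d.exists_left_coeff_sumD_psi hp hsP
  have hode : ∀ j, ∀ e ∈ chainGroup φ ψ j,
      ∑ j ∈ Finset.range (p + 1), β j * d.D^[j] e + β (p + 1) * d.D^[p + 1] e = 0 := by
    intro j e he
    have h1 := hsol j e he
    rw [show d.psi e = d.base.psi e from rfl, hβs, Finset.sum_range_succ] at h1
    simp only [AddMonoid.End.coe_pow] at h1
    exact h1
  refine exists_le_of_jets (chainGroup φ ψ) (chainGroup_mono φ ψ) d.D d.D_one ?_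
    (fun j => d.D^[j]) (fun _ => rfl) (p + 1) (by omega) ?_
  · intro k hk j
    induction j generalizing k with
    | zero =>
      intro e he
      rw [AddSubgroup.mem_bot.1 he, mul_zero]
      exact zero_mem _
    | succ j ih =>
      intro e he
      obtain ⟨e', he', h⟩ := mem_chainGroup_succ.1 he
      -- The multiplier k at e becomes T k at its predecessor, which is why the induction
      -- generalizes over k.
      have hk' : d.D (d.T k) = 0 := by rw [← d.comm, hk, map_zero]
      refine mem_chainGroup_succ.2 ⟨d.T k * e', ih _ hk' e' he', ?_⟩
      change d.psi e' = d.phi e at h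
      show d.psi (d.T k * e') = d.phi (k * e)
      have h1 : d.psi (d.T k * e') = d.T k * d.psi e' := by
        simp only [psi, d.leibniz, hk']; ring
      rw [h1, h]
      simp only [phi, d.leibniz, hk, map_mul, map_add]
      simp
      ring
  · intro P k e he hrel
    -- The ODE expresses the derivative of order p + 1 through the lower ones, so the relation
    -- extends by one order. Differentiating a relation and removing the next one leaves the
    -- relation with coefficients `D (k i)`.
    have hlast : ∑ i ∈ Finset.range P, k i * d.D^[p + 1] (e i) = 0 := by
      refine (mul_eq_zero.1 (?_ : β (p + 1) * _ = 0)).resolve_left hβ0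
      calc _ = ∑ i ∈ Finset.range P, k i * (β (p + 1) * d.D^[p + 1] (e i)) +
            ∑ j ∈ Finset.range (p + 1), β j * ∑ i ∈ Finset.range P, k i * d.D^[j] (e i) := by
            rw [Finset.sum_eq_zero (s := Finset.range (p + 1)) fun j hj => by
              rw [hrel j (Finset.mem_range.1 hj), mul_zero], add_zero, Finset.mul_sum]
            exact Finset.sum_congr rfl fun i _ => by ring
        _ = ∑ i ∈ Finset.range P, k i * (∑ j ∈ Finset.range (p + 1), β j * d.D^[j] (e i) +
            β (p + 1) * d.D^[p + 1] (e i)) := by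
            simp only [Finset.mul_sum, mul_add, Finset.sum_add_distrib]
            rw [add_comm, Finset.sum_comm]
            congr 1
            exact Finset.sum_congr rfl fun i _ => Finset.sum_congr rfl fun j _ => by ring
        _ = 0 := Finset.sum_eq_zero fun i _ => by
            obtain ⟨j, hj⟩ := he i
            rw [hode j _ hj, mul_zero]
    intro j hj
    have h1 : ∑ i ∈ Finset.range P, k i * d.D^[j + 1] (e i) = 0 := by
      rcases (by omega : j + 1 < p + 1 ∨ j = p) with h | rfl
      exacts [hrel _ h, hlast]
    have h2 := congrArg d.D (hrel j hj)
    simp only [map_sum, d.leibniz, Finset.sum_add_distrib, map_zero] at h2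
    simp only [Function.iterate_succ_apply'] at h1
    rwa [h1, add_zero] at h2

/-- Now the adjoint S-chain gives long chains, and the adjoint R-chain gives a recurrence N(T - a) e
= 0 for the last elements; constants are the elements fixed by T. -/
theorem chainS_of_adjoint (hR : d.adjoint.ChainR) (hS : d.adjoint.ChainS) : d.ChainS := by
  let φ : K →+ K := AddMonoidHom.mk' d.shiftSub d.shiftSub_add
  let ψ : K →+ K := AddMonoidHom.mk' (fun e => -d.lin e) d.neg_lin_add
  refine finChain_of_stable φ ψ (d.exists_long_chainS hS) ?_
  obtain ⟨n, ⟨p, hp, htop⟩, h0, hn⟩ := hR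
  have hnP := htop (p + 1) (by omega)
  have hsol : ∀ j, ∀ e ∈ chainGroup φ ψ j, d.base.sumT (p + 1) n (d.shiftSub e) = 0 := by
    intro j
    induction j with
    | zero =>
      intro e he
      rw [AddSubgroup.mem_bot.1 he]
      simp [Rep.sumT, shiftSub]
    | succ j ih =>
      intro e he
      obtain ⟨e', he', h⟩ := mem_chainGroup_succ.1 he
      have h1 := d.base.dd_sumT hnP h0 hn e'
      rw [show d.base.shiftSub e' = d.shiftSub e' from rfl, ih e' he', map_zero] at h1
      have h2 := d.base.sumT_add (p + 1) n (d.base.lin e') (-d.base.lin e')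
      rw [← h1, add_neg_cancel, zero_add] at h2
      rw [show d.shiftSub e = -d.base.lin e' from h.symm, ← h2]
      simp [Rep.sumT]
  have hrec : ∀ j, ∀ e ∈ chainGroup φ ψ j, ∑ k ∈ Finset.range (p + 1),
      (d.T^[k] (n k) * d.T^[k + 1] e - d.T^[k] (n k * d.a) * d.T^[k] e) = 0 := by
    intro j e he
    rw [← hsol j e he]
    refine Finset.sum_congr rfl fun k _ => ?_
    rw [d.base.t_pow_smul, shiftSub, AddMonoid.End.coe_pow]
    show _ = d.T^[k] (n k) * d.T^[k] (d.T e - d.a * e)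
    rw [iterate_map_sub, iterate_map_mul, iterate_map_mul, Function.iterate_succ_apply]
    ring
  refine exists_le_of_jets (chainGroup φ ψ) (chainGroup_mono φ ψ)
    (fun k => k - d.T.symm k) (by simp) ?_
    (fun j => d.T^[j]) (fun _ => rfl) (p + 1) (by omega) ?_
  · intro k hk j
    induction j generalizing k with
    | zero =>
      intro e he
      rw [AddSubgroup.mem_bot.1 he, mul_zero]
      exact zero_mem _
    | succ j ih =>
      intro e he
      obtain ⟨e', he', h⟩ := mem_chainGroup_succ.1 he
      have hTk : d.T k = k := by
        conv_lhs => rw [sub_eq_zero.1 hk]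
        simp
      have hDk : d.T (d.D k) = d.D k := by rw [d.comm, hTk]
      have hDk' : d.D k - d.T.symm (d.D k) = 0 := by
        rw [sub_eq_zero, d.symm_comm, ← sub_eq_zero.1 hk]
      -- For T k = k, lin(ke') = k lin e' + shiftSub(D(k) e'). The predecessor k e' therefore needs
      -- a correction `e₂` with -lin `e₂` = shiftSub(D(k) e'); it exists because D(k) is also fixed
      -- by T.
      obtain ⟨e₂, he₂, h₂⟩ := mem_chainGroup_succ.1
        (chainGroup_le_succ φ ψ j (ih _ hDk' e' he'))
      refine mem_chainGroup_succ.2 ⟨k * e' + e₂, add_mem (ih k hk e' he') he₂, ?_⟩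
      rw [map_add, h₂]
      change -d.lin e' = d.shiftSub e at h
      show -d.lin (k * e') + d.shiftSub (d.D k * e') = d.shiftSub (k * e)
      have h1 : d.shiftSub (k * e) = k * d.shiftSub e := by
        simp only [shiftSub, map_mul, hTk]; ring
      rw [h1, ← h]
      simp only [lin, phi, psi, shiftSub, map_mul, d.leibniz, map_add, hTk, hDk]
      ring
  · intro P k e he hrel
    have hlast : ∑ i ∈ Finset.range P, k i * d.T^[p + 1] (e i) = 0 := by
      refine (mul_eq_zero.1 (?_ : d.T^[p] (n p) * _ = 0)).resolve_left fun h =>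
        hp ((d.iterate_T_bijective p).injective (h.trans (d.iterate_T_zero p).symm))
      have h1 : ∑ l ∈ Finset.range (p + 1), (d.T^[l] (n l) *
          (∑ i ∈ Finset.range P, k i * d.T^[l + 1] (e i)) -
          d.T^[l] (n l * d.a) * ∑ i ∈ Finset.range P, k i * d.T^[l] (e i)) = 0 := by
        calc _ = ∑ i ∈ Finset.range P, k i * ∑ l ∈ Finset.range (p + 1),
              (d.T^[l] (n l) * d.T^[l + 1] (e i) - d.T^[l] (n l * d.a) * d.T^[l] (e i)) := by
              simp only [Finset.mul_sum, ← Finset.sum_sub_distrib]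
              rw [Finset.sum_comm]
              exact Finset.sum_congr rfl fun i _ => Finset.sum_congr rfl fun j _ => by ring
          _ = 0 := Finset.sum_eq_zero fun i _ => by
              obtain ⟨j, hj⟩ := he i
              rw [hrec j _ hj, mul_zero]
      rw [Finset.sum_range_succ, Finset.sum_eq_zero fun l hl => ?_, zero_add, hrel p (by omega),
        mul_zero, sub_zero] at h1
      · exact h1
      · rw [Finset.mem_range] at hl
        rw [hrel _ (by omega), hrel _ (by omega), mul_zero, mul_zero, sub_zero]
    intro j hj
    have h1 : ∑ i ∈ Finset.range P, k i * d.T^[j + 1] (e i) = 0 := by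
      rcases (by omega : j + 1 < p + 1 ∨ j = p) with h | rfl
      exacts [hrel _ h, hlast]
    -- Applying T⁻¹ to the relation for the jet j + 1 gives one for the jet j with coefficients T⁻¹
    -- k; subtraction produces k - T⁻¹ k.
    have h2 := congrArg d.T.symm h1
    simp only [map_sum, map_mul, map_zero, Function.iterate_succ_apply',
      RingEquiv.symm_apply_apply] at h2
    simp only [sub_mul, Finset.sum_sub_distrib, hrel j hj, h2, sub_zero]

theorem chains_iff_adjoint :
    d.adjoint.ChainR ∧ d.adjoint.ChainS ↔ d.ChainR ∧ d.ChainS := by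
  have key : ∀ d : LinData K, d.adjoint.ChainR ∧ d.adjoint.ChainS → d.ChainR ∧ d.ChainS :=
    fun d h => ⟨d.chainR_of_adjoint h.1 h.2, d.chainS_of_adjoint h.1 h.2⟩
  refine ⟨key d, fun h => key d.adjoint ?_⟩
  rwa [d.adjoint_adjoint]

end LinData

/-! ### Total derivative and shift on analytic functions -/

open PreEquation

namespace PreEquation

variable {𝕜 : Type*} [RCLike 𝕜] {E : PreEquation 𝕜}

/-- The derivatives of finitely many variables at a point. -/
def projDeriv (s : Finset DynVar) (P : E.Point) : s → 𝕜 := fun c => coordDeriv c.1 P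

/-- The restriction of the values of variables to a subset of the variables. -/
noncomputable def restrictVars {s t : Finset DynVar} (h : s ⊆ t) : (t → 𝕜) →L[𝕜] (s → 𝕜) :=
  ContinuousLinearMap.pi fun c => ContinuousLinearMap.proj (⟨c.1, h c.2⟩ : t)

theorem DependsAnalytically.add {s : Finset DynVar} {f g : E.Point → 𝕜}
    (hf : DependsAnalytically s f) (hg : DependsAnalytically s g) :
    DependsAnalytically s (f + g) := by
  obtain ⟨F, hF, hfF⟩ := hf
  obtain ⟨G, hG, hgG⟩ := hg
  exact ⟨F + G, hF.add hG, fun P => by simp [hfF, hgG]⟩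

theorem DependsAnalytically.mul {s : Finset DynVar} {f g : E.Point → 𝕜}
    (hf : DependsAnalytically s f) (hg : DependsAnalytically s g) :
    DependsAnalytically s (f * g) := by
  obtain ⟨F, hF, hfF⟩ := hf
  obtain ⟨G, hG, hgG⟩ := hg
  exact ⟨F * G, hF.mul hG, fun P => by simp [hfF, hgG]⟩

theorem dependsAnalytically_const (s : Finset DynVar) (k : 𝕜) :
    DependsAnalytically (E := E) s fun _ => k :=
  ⟨fun _ => k, fun _ _ => analyticAt_const, fun _ => rfl⟩

theorem DependsAnalytically.sub {s : Finset DynVar} {f g : E.Point → 𝕜}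
    (hf : DependsAnalytically s f) (hg : DependsAnalytically s g) :
    DependsAnalytically s (f - g) := by
  obtain ⟨F, hF, hfF⟩ := hf
  obtain ⟨G, hG, hgG⟩ := hg
  exact ⟨F - G, hF.sub hG, fun P => by simp [hfF, hgG]⟩

theorem DependsAnalytically.sum {ι : Type*} {s : Finset DynVar} (J : Finset ι)
    {f : ι → E.Point → 𝕜} (hf : ∀ j ∈ J, DependsAnalytically s (f j)) :
    DependsAnalytically s fun P => ∑ j ∈ J, f j P := by
  classical
  induction J using Finset.induction_on with
  | empty => simpa using dependsAnalytically_const s 0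
  | insert j J hj ih =>
    simp only [Finset.sum_insert hj]
    exact (hf j (Finset.mem_insert_self _ _)).add
      (ih fun i hi => hf i (Finset.mem_insert_of_mem hi))

end PreEquation

namespace Equation

variable {𝕜 : Type*} [RCLike 𝕜] {E : Equation 𝕜}

/-- Pulled back to the variables `s ∪ t`, the two representations agree on an open set, hence have
the same derivative there. This makes D independent of the chosen representation. -/
theorem fderiv_unique {s t : Finset DynVar} {g : (s → 𝕜) → 𝕜} {h : (t → 𝕜) → 𝕜}
    (hg : AnalyticOnNhd 𝕜 g (Set.range (proj (E := E.toPreEquation) s)))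
    (hh : AnalyticOnNhd 𝕜 h (Set.range (proj (E := E.toPreEquation) t)))
    (hgh : ∀ P : E.Point, g (proj s P) = h (proj t P)) (P : E.Point) :
    fderiv 𝕜 g (proj s P) (projDeriv s P) = fderiv 𝕜 h (proj t P) (projDeriv t P) := by
  classical
  have hst : s ⊆ s ∪ t := Finset.subset_union_left
  have hts : t ⊆ s ∪ t := Finset.subset_union_right
  have h1 : fderiv 𝕜 (fun z => g (restrictVars hst z)) (proj (s ∪ t) P) (projDeriv (s ∪ t) P) =
      fderiv 𝕜 g (proj s P) (projDeriv s P) := by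
    have := ((hg _ ⟨P, rfl⟩).differentiableAt.hasFDerivAt (x := restrictVars hst
      (proj (s ∪ t) P))).comp (proj (s ∪ t) P) (restrictVars (𝕜 := 𝕜) hst).hasFDerivAt
    rw [show (fun z => g (restrictVars hst z)) = g ∘ restrictVars (𝕜 := 𝕜) hst from rfl,
      this.fderiv]
    rfl
  have h2 : fderiv 𝕜 (fun z => h (restrictVars hts z)) (proj (s ∪ t) P) (projDeriv (s ∪ t) P) =
      fderiv 𝕜 h (proj t P) (projDeriv t P) := by
    have := ((hh _ ⟨P, rfl⟩).differentiableAt.hasFDerivAt (x := restrictVars hts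
      (proj (s ∪ t) P))).comp (proj (s ∪ t) P) (restrictVars (𝕜 := 𝕜) hts).hasFDerivAt
    rw [show (fun z => h (restrictVars hts z)) = h ∘ restrictVars (𝕜 := 𝕜) hts from rfl,
      this.fderiv]
    rfl
  rw [← h1, ← h2]
  congr 1
  refine Filter.EventuallyEq.fderiv_eq ?_
  filter_upwards [(E.isOpen_range (s ∪ t)).mem_nhds ⟨P, rfl⟩]
  rintro _ ⟨Q, rfl⟩
  exact hgh Q

theorem fderiv_apply_eq_sum {s : Finset DynVar} (g : (s → 𝕜) → 𝕜) (z v : s → 𝕜) :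
    fderiv 𝕜 g z v = ∑ c : s, fderiv 𝕜 g z (Pi.single c 1) * v c := by
  classical
  conv_lhs => rw [pi_eq_sum_univ' v, map_sum]
  refine Finset.sum_congr rfl fun c _ => ?_
  rw [map_smul, smul_eq_mul, mul_comm]

/-- The total derivative can be computed from any representation of the function. -/
theorem totalDeriv_apply (f : E.analyticFun) {s : Finset DynVar} {g : (s → 𝕜) → 𝕜}
    (hg : AnalyticOnNhd 𝕜 g (Set.range (proj (E := E.toPreEquation) s)))
    (hf : ∀ P : E.Point, f.1 P = g (proj s P)) (P : E.Point) :
    (totalDeriv f).1 P = fderiv 𝕜 g (proj s P) (projDeriv s P) := by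
  have h := (exists_dependsAnalytically f).choose_spec.choose_spec
  rw [← fderiv_unique h.1 hg (fun Q => by rw [← h.2, hf]) P, fderiv_apply_eq_sum]
  rfl

theorem exists_common_vars (f g : E.analyticFun) : ∃ s : Finset DynVar,
    DependsAnalytically s f.1 ∧ DependsAnalytically s g.1 := by
  classical
  obtain ⟨s, hs⟩ := f.2
  obtain ⟨t, ht⟩ := g.2
  exact ⟨s ∪ t, hs.mono Finset.subset_union_left, ht.mono Finset.subset_union_right⟩

theorem totalDeriv_add (f g : E.analyticFun) :
    totalDeriv (f + g) = totalDeriv f + totalDeriv g := by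
  obtain ⟨s, ⟨F, hF, hfF⟩, G, hG, hgG⟩ := exists_common_vars f g
  refine Subtype.ext (funext fun P => ?_)
  rw [totalDeriv_apply (f + g) (g := F + G) (hF.add hG)
    (fun Q => by simp [← hfF, ← hgG]), fderiv_add (hF _ ⟨P, rfl⟩).differentiableAt
    (hG _ ⟨P, rfl⟩).differentiableAt]
  simp [totalDeriv_apply f hF hfF, totalDeriv_apply g hG hgG]

theorem totalDeriv_mul (f g : E.analyticFun) :
    totalDeriv (f * g) = totalDeriv f * g + f * totalDeriv g := by
  obtain ⟨s, ⟨F, hF, hfF⟩, G, hG, hgG⟩ := exists_common_vars f g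
  refine Subtype.ext (funext fun P => ?_)
  rw [totalDeriv_apply (f * g) (g := F * G) (hF.mul hG)
    (fun Q => by simp [← hfF, ← hgG]), fderiv_mul (hF _ ⟨P, rfl⟩).differentiableAt
    (hG _ ⟨P, rfl⟩).differentiableAt]
  simp [totalDeriv_apply f hF hfF, totalDeriv_apply g hG hgG, hfF, hgG]
  ring

/-- The variables as functions. -/
def coordFun (c : DynVar) : E.analyticFun := ⟨coord c, dependsAnalytically_coord c⟩

theorem totalDeriv_coordFun (c : DynVar) (P : E.Point) :
    (totalDeriv (coordFun (E := E) c)).1 P = coordDeriv c P := by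
  rw [totalDeriv_apply (coordFun c) (s := {c}) (g := fun z => z ⟨c, by simp⟩)
    (fun z _ => analyticAt_apply _) (fun _ => rfl)]
  have := (ContinuousLinearMap.proj (R := 𝕜) (φ := fun _ : ({c} : Finset DynVar) => 𝕜)
    ⟨c, by simp⟩).hasFDerivAt (x := proj (E := E.toPreEquation) {c} P)
  rw [show (fun z : ({c} : Finset DynVar) → 𝕜 => z ⟨c, by simp⟩) =
    (ContinuousLinearMap.proj (R := 𝕜) (φ := fun _ : ({c} : Finset DynVar) => 𝕜)
    ⟨c, by simp⟩) from rfl, this.fderiv]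
  rfl

/-- The chain rule for a substitution compatible with the total derivative. -/
theorem totalDeriv_comp {Θ : E.Point → E.Point}
    (hΘ : ∀ c, ∃ y : E.analyticFun, (∀ P, y.1 P = coord c (Θ P)) ∧
      ∀ P, (totalDeriv y).1 P = coordDeriv c (Θ P))
    {f F : E.analyticFun} (hF : ∀ P, F.1 P = f.1 (Θ P)) (P : E.Point) :
    (totalDeriv F).1 P = (totalDeriv f).1 (Θ P) := by
  classical
  choose y hy hyD using hΘ
  obtain ⟨s, g, hg, hfg⟩ := f.2
  have hdep : ∃ t, ∀ c : s, DependsAnalytically t (y c).1 := by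
    choose t ht using fun c : s => (y c).2
    exact ⟨Finset.univ.biUnion t, fun c =>
      (ht c).mono (Finset.subset_biUnion_of_mem t (Finset.mem_univ c))⟩
  obtain ⟨t, ht⟩ := hdep
  choose h hh hyh using ht
  have hpt : ∀ Q, (fun c => h c (proj t Q)) = proj (E := E.toPreEquation) s (Θ Q) := fun Q =>
    funext fun c => by rw [← hyh]; exact hy c Q
  have hh' : ∀ Q : E.Point, AnalyticAt 𝕜 (fun z => fun c => h c z) (proj t Q) := fun Q =>
    AnalyticAt.pi fun c => hh c _ ⟨Q, rfl⟩
  have hgh : AnalyticOnNhd 𝕜 (fun z => g fun c => h c z)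
      (Set.range (proj (E := E.toPreEquation) t)) := by
    rintro _ ⟨Q, rfl⟩
    refine AnalyticAt.fun_comp (f := fun z => fun c => h c z) ?_ (hh' Q)
    rw [hpt]
    exact hg _ ⟨_, rfl⟩
  rw [totalDeriv_apply F hgh fun Q => by rw [hF, hfg, hpt], totalDeriv_apply f hg hfg]
  have hgd : HasFDerivAt g (fderiv 𝕜 g (proj s (Θ P))) ((fun z => fun c => h c z) (proj t P)) := by
    show HasFDerivAt g _ (fun c => h c (proj t P))
    rw [hpt]
    exact (hg _ ⟨_, rfl⟩).differentiableAt.hasFDerivAt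
  have hhd : HasFDerivAt (fun z => fun c => h c z)
      (ContinuousLinearMap.pi fun c => fderiv 𝕜 (h c) (proj t P)) (proj t P) :=
    hasFDerivAt_pi.2 fun c => (hh c _ ⟨P, rfl⟩).differentiableAt.hasFDerivAt
  have hcomp := hgd.comp (proj t P) hhd
  rw [show (fun z => g fun c => h c z) = g ∘ (fun z => fun c => h c z) from rfl, hcomp.fderiv]
  rw [ContinuousLinearMap.comp_apply]
  congr 1
  ext c
  exact (totalDeriv_apply (y c) (hh c) (hyh c) P).symm.trans (hyD c P)

theorem shiftPoint_compatible (c : DynVar) : ∃ y : E.analyticFun,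
    (∀ P, y.1 P = coord c (shiftPoint P)) ∧
      ∀ P, (totalDeriv y).1 P = coordDeriv c (shiftPoint P) := by
  match c with
  | .x => exact ⟨coordFun .x, fun _ => rfl, fun P => totalDeriv_coordFun .x P⟩
  | .u p => exact ⟨coordFun (.u (p + 1)), fun _ => rfl, fun P => totalDeriv_coordFun _ P⟩
  | .d 0 => exact ⟨E.rhs, fun P => (P.eqn 0).symm, fun P => rfl⟩
  | .d (q + 1) =>
    refine ⟨totalDeriv^[q + 1] E.rhs, fun P => rfl, fun P => ?_⟩
    rw [← Function.iterate_succ_apply' totalDeriv]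
    rfl

theorem totalDeriv_shift (f : E.analyticFun) : totalDeriv (shift f) = shift (totalDeriv f) :=
  Subtype.ext (funext fun P => totalDeriv_comp shiftPoint_compatible (fun _ => rfl) P)

/-- The derivatives of the shifts of `u` as functions. -/
def uxFun (E : Equation 𝕜) (p : ℤ) : E.analyticFun := ⟨fun P => P.ux p, ux_mem p⟩

/-- The backward shift on points. -/
noncomputable def unshiftPoint (P : E.Point) : E.Point where
  x := P.x
  u p := P.u (p - 1)
  ux p := P.ux (p - 1)
  higher q := (totalDeriv^[q + 1] (E.uxFun (-1))).1 P
  mem_dom p := by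
    have := P.mem_dom (p - 1)
    rw [sub_add_cancel] at this
    rwa [add_sub_cancel_right]
  eqn p := by
    have := P.eqn (p - 1)
    rw [sub_add_cancel] at this
    rw [add_sub_cancel_right]
    exact this

theorem unshiftPoint_compatible (c : DynVar) : ∃ y : E.analyticFun,
    (∀ P, y.1 P = coord c (unshiftPoint P)) ∧
      ∀ P, (totalDeriv y).1 P = coordDeriv c (unshiftPoint P) := by
  match c with
  | .x => exact ⟨coordFun .x, fun _ => rfl, fun P => totalDeriv_coordFun .x P⟩
  | .u p => exact ⟨coordFun (.u (p - 1)), fun _ => rfl, fun P => totalDeriv_coordFun _ P⟩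
  | .d 0 => exact ⟨E.uxFun (-1), fun P => rfl, fun P => rfl⟩
  | .d (q + 1) =>
    refine ⟨totalDeriv^[q + 1] (E.uxFun (-1)), fun P => rfl, fun P => ?_⟩
    rw [← Function.iterate_succ_apply' totalDeriv]
    rfl

/-- The backward shift on analytic functions. -/
noncomputable def unshift (f : E.analyticFun) : E.analyticFun :=
  ⟨fun P => f.1 (unshiftPoint P), by
    obtain ⟨s, g, hg, hfg⟩ := f.2
    refine DependsAnalytically.comp (E := E.toPreEquation) (h := g)
      (y := fun c P => coord c.1 (unshiftPoint P)) (fun c => ?_)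
      (fun P => hg _ ⟨unshiftPoint P, rfl⟩) (fun P => hfg _)
    obtain ⟨y, hy, -⟩ := unshiftPoint_compatible (E := E) c.1
    rw [← funext hy]
    exact y.2⟩

theorem totalDeriv_unshift (f : E.analyticFun) :
    totalDeriv (unshift f) = unshift (totalDeriv f) :=
  Subtype.ext (funext fun P => totalDeriv_comp unshiftPoint_compatible (fun _ => rfl) P)

theorem iterate_totalDeriv_coordFun (q : ℕ) :
    totalDeriv^[q] (coordFun (E := E) (.d 0)) = coordFun (.d q) := by
  induction q with
  | zero => rfl
  | succ q ih =>
    rw [Function.iterate_succ_apply', ih]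
    exact Subtype.ext (funext fun P => totalDeriv_coordFun _ P)

/-- Only the higher derivatives need an argument: the backward shift turns F into u_x and commutes
with D, so it turns the derivatives of F into those of u_x. -/
theorem shiftPoint_unshiftPoint (P : E.Point) : shiftPoint (unshiftPoint P) = P := by
  refine Point.ext rfl ?_ ?_ ?_
  · exact funext fun p => congrArg P.u (add_sub_cancel_right p 1)
  · exact funext fun p => congrArg P.ux (add_sub_cancel_right p 1)
  · funext q
    have h1 : unshift E.rhs = coordFun (.d 0) :=
      Subtype.ext (funext fun P => by
        have := P.eqn (-1)
        rw [neg_add_cancel] at this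
        exact this.symm)
    have h2 := Function.Commute.iterate_left
      (show Function.Commute totalDeriv (unshift (E := E)) from totalDeriv_unshift) (q + 1) E.rhs
    rw [h1, iterate_totalDeriv_coordFun] at h2
    exact (congrFun (congrArg Subtype.val h2) P).symm

theorem unshiftPoint_shiftPoint (P : E.Point) : unshiftPoint (shiftPoint P) = P := by
  refine Point.ext rfl ?_ ?_ ?_
  · exact funext fun p => congrArg P.u (sub_add_cancel p 1)
  · exact funext fun p => congrArg P.ux (sub_add_cancel p 1)
  · funext q
    have h1 : shift (E.uxFun (-1)) = coordFun (.d 0) := rfl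
    have h2 := Function.Commute.iterate_left
      (show Function.Commute totalDeriv (shift (E := E)) from totalDeriv_shift) (q + 1)
        (E.uxFun (-1))
    rw [h1, iterate_totalDeriv_coordFun] at h2
    exact (congrFun (congrArg Subtype.val h2) P).symm

/-- The shift as an automorphism of the ring of analytic functions. -/
noncomputable def shiftEquiv (E : Equation 𝕜) : E.analyticFun ≃+* E.analyticFun where
  toFun := shift
  invFun := unshift
  left_inv f := Subtype.ext (funext fun P => congrArg f.1 (shiftPoint_unshiftPoint P))
  right_inv f := Subtype.ext (funext fun P => congrArg f.1 (unshiftPoint_shiftPoint P))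
  map_mul' _ _ := rfl
  map_add' _ _ := rfl

/-! ### The field of functions with T and D -/

theorem algebraMap_ne_zero {b : E.analyticFun} (hb : b ≠ 0) : algebraMap _ E.Fun b ≠ 0 :=
  (map_ne_zero_iff _ (IsFractionRing.injective E.analyticFun E.Fun)).2 hb

theorem exists_div (f : E.Fun) : ∃ a b : E.analyticFun, b ≠ 0 ∧
    f = algebraMap _ E.Fun a / algebraMap _ E.Fun b := by
  obtain ⟨a, b, hb, rfl⟩ := IsFractionRing.div_surjective (A := E.analyticFun) f
  exact ⟨a, b, nonZeroDivisors.ne_zero hb, rfl⟩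

theorem sec_spec (f : E.Fun) :
    (IsLocalization.sec (nonZeroDivisors E.analyticFun) f).2.1 ≠ 0 ∧
    f = algebraMap _ E.Fun (IsLocalization.sec (nonZeroDivisors E.analyticFun) f).1 /
      algebraMap _ E.Fun (IsLocalization.sec (nonZeroDivisors E.analyticFun) f).2.1 := by
  have h := nonZeroDivisors.ne_zero (IsLocalization.sec (nonZeroDivisors E.analyticFun) f).2.2
  exact ⟨h, eq_div_of_mul_eq (algebraMap_ne_zero h)
    (IsLocalization.sec_spec (nonZeroDivisors E.analyticFun) f)⟩

/-- The shift as an automorphism of the field of functions. -/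
noncomputable def TEquiv (E : Equation 𝕜) : E.Fun ≃+* E.Fun :=
  IsFractionRing.ringEquivOfRingEquiv E.shiftEquiv

theorem TEquiv_algebraMap (a : E.analyticFun) :
    E.TEquiv (algebraMap _ _ a) = algebraMap _ _ (shift a) :=
  IsFractionRing.ringEquivOfRingEquiv_algebraMap _ _

theorem T_eq (f : E.Fun) : T f = E.TEquiv f := by
  conv_rhs => rw [(sec_spec f).2, map_div₀, TEquiv_algebraMap, TEquiv_algebraMap]
  rfl

theorem T_div (a b : E.analyticFun) :
    T (algebraMap _ E.Fun a / algebraMap _ E.Fun b) =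
      algebraMap _ E.Fun (shift a) / algebraMap _ E.Fun (shift b) := by
  rw [T_eq, map_div₀, TEquiv_algebraMap, TEquiv_algebraMap]

theorem D_div (a : E.analyticFun) {b : E.analyticFun} (hb : b ≠ 0) :
    D (algebraMap _ E.Fun a / algebraMap _ E.Fun b) =
      algebraMap _ E.Fun (b * totalDeriv a - a * totalDeriv b) / algebraMap _ E.Fun b ^ 2 := by
  obtain ⟨hb', h⟩ := sec_spec (algebraMap _ E.Fun a / algebraMap _ E.Fun b)
  unfold D
  generalize (IsLocalization.sec (nonZeroDivisors E.analyticFun)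
    (algebraMap _ E.Fun a / algebraMap _ E.Fun b)).2.1 = b' at h hb' ⊢
  generalize (IsLocalization.sec (nonZeroDivisors E.analyticFun)
    (algebraMap _ E.Fun a / algebraMap _ E.Fun b)).1 = a' at h ⊢
  rw [div_eq_div_iff (algebraMap_ne_zero hb) (algebraMap_ne_zero hb'), ← map_mul, ← map_mul] at h
  have h := IsFractionRing.injective E.analyticFun E.Fun h
  have hD := congrArg totalDeriv h
  rw [totalDeriv_mul, totalDeriv_mul] at hD
  dsimp only
  rw [div_eq_div_iff (pow_ne_zero _ (algebraMap_ne_zero hb'))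
    (pow_ne_zero _ (algebraMap_ne_zero hb)), ← map_pow, ← map_pow, ← map_mul, ← map_mul]
  congr 1
  -- Independence of the fraction: the cross-multiplied quotient rules differ by a combination of a
  -- b' = a' b and its derivative.
  linear_combination (-b * b') * hD + (totalDeriv b * b' + b * totalDeriv b') * h

theorem D_add (f g : E.Fun) : D (f + g) = D f + D g := by
  obtain ⟨a, b, hb, rfl⟩ := exists_div f
  obtain ⟨a', b', hb', rfl⟩ := exists_div g
  have h1 := algebraMap_ne_zero hb
  have h2 := algebraMap_ne_zero hb'
  rw [div_add_div _ _ h1 h2, ← map_mul, ← map_mul, ← map_mul, ← map_add,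
    D_div _ (mul_ne_zero hb hb'), D_div _ hb, D_div _ hb']
  simp only [totalDeriv_add, totalDeriv_mul, map_mul, map_add, map_sub]
  field_simp
  ring

theorem D_mul (f g : E.Fun) : D (f * g) = D f * g + f * D g := by
  obtain ⟨a, b, hb, rfl⟩ := exists_div f
  obtain ⟨a', b', hb', rfl⟩ := exists_div g
  have h1 := algebraMap_ne_zero hb
  have h2 := algebraMap_ne_zero hb'
  rw [div_mul_div_comm, ← map_mul, ← map_mul,
    D_div _ (mul_ne_zero hb hb'), D_div _ hb, D_div _ hb']
  simp only [totalDeriv_mul, map_mul, map_add, map_sub]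
  field_simp
  ring

theorem T_D (f : E.Fun) : T (D f) = D (T f) := by
  obtain ⟨a, b, hb, rfl⟩ := exists_div f
  have hb' : shift b ≠ 0 := (map_ne_zero_iff _ E.shiftEquiv.injective).2 hb
  have h1 : ∀ f g : E.analyticFun, shift (f * g) = shift f * shift g := fun _ _ => rfl
  have h2 : ∀ f g : E.analyticFun, shift (f - g) = shift f - shift g := fun _ _ => rfl
  rw [D_div _ hb, T_div, D_div _ hb', ← map_pow, T_div, pow_two, h1, h2, h1, h1,
    totalDeriv_shift, totalDeriv_shift, pow_two, map_mul]

theorem totalDeriv_one : totalDeriv (1 : E.analyticFun) = 0 := by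
  have := totalDeriv_mul (1 : E.analyticFun) 1
  simpa using this

theorem D_algebraMap (a : E.analyticFun) :
    D (algebraMap _ E.Fun a) = algebraMap _ E.Fun (totalDeriv a) := by
  have h := D_div a (one_ne_zero (α := E.analyticFun))
  simpa [totalDeriv_one] using h

theorem Fux_ne_zero (E : Equation 𝕜) : E.Fux ≠ 0 := by
  refine algebraMap_ne_zero fun h => ?_
  obtain ⟨_, P, -⟩ := (E.isConnected_range ∅).nonempty
  exact E.deriv_ne_zero _ (base_mem P) (congrFun (congrArg Subtype.val h) P)

/-- The field of functions with shift, total derivative and linearization operator. -/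
noncomputable def data (E : Equation 𝕜) : LinData E.Fun where
  T := E.TEquiv
  D := AddMonoidHom.mk' D D_add
  leibniz := D_mul
  comm f := by
    show E.TEquiv (D f) = D (E.TEquiv f)
    rw [← T_eq, ← T_eq, T_D]
  a := E.Fux
  b := E.Fu1
  c := E.Fu
  a_ne := E.Fux_ne_zero

/-- The independent variable as a function. -/
noncomputable def xFun (E : Equation 𝕜) : E.Fun :=
  algebraMap _ _ (coordFun (E := E) .x)

theorem D_xFun : D E.xFun = 1 := by
  rw [xFun, D_algebraMap, ← map_one (algebraMap E.analyticFun E.Fun)]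
  congr 1
  exact Subtype.ext (funext fun P => totalDeriv_coordFun _ P)

theorem T_xFun : T E.xFun = E.xFun := by
  rw [T_eq, xFun, TEquiv_algebraMap]
  rfl

instance : CharZero E.analyticFun := by
  refine ⟨fun m n h => ?_⟩
  obtain ⟨_, P, -⟩ := (E.isConnected_range ∅).nonempty
  have h1 := congrFun (congrArg Subtype.val h) P
  simpa using h1

instance : CharZero E.Fun :=
  charZero_of_injective_algebraMap (IsFractionRing.injective E.analyticFun E.Fun)

/-! ### Uniform finite sets of variables for functions depending on i -/

/-- `f` is a quotient of analytic functions of the variables in `s`. -/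
def FunOf (s : Finset DynVar) (f : E.Fun) : Prop :=
  ∃ a b : E.analyticFun, DependsAnalytically s a.1 ∧ DependsAnalytically s b.1 ∧ b ≠ 0 ∧
    f = algebraMap _ E.Fun a / algebraMap _ E.Fun b

theorem FunOf.mono {s t : Finset DynVar} (h : s ⊆ t) {f : E.Fun} (hf : FunOf s f) :
    FunOf t f := by
  obtain ⟨a, b, ha, hb, hb0, rfl⟩ := hf
  exact ⟨a, b, ha.mono h, hb.mono h, hb0, rfl⟩

theorem FunOf.add {s : Finset DynVar} {f g : E.Fun} (hf : FunOf s f) (hg : FunOf s g) :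
    FunOf s (f + g) := by
  obtain ⟨a, b, ha, hb, hb0, rfl⟩ := hf
  obtain ⟨a', b', ha', hb', hb0', rfl⟩ := hg
  refine ⟨a * b' + b * a', b * b', (ha.mul hb').add (hb.mul ha'), hb.mul hb',
    mul_ne_zero hb0 hb0', ?_⟩
  rw [div_add_div _ _ (algebraMap_ne_zero hb0) (algebraMap_ne_zero hb0')]
  simp

theorem FunOf.mul {s : Finset DynVar} {f g : E.Fun} (hf : FunOf s f) (hg : FunOf s g) :
    FunOf s (f * g) := by
  obtain ⟨a, b, ha, hb, hb0, rfl⟩ := hf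
  obtain ⟨a', b', ha', hb', hb0', rfl⟩ := hg
  refine ⟨a * a', b * b', ha.mul ha', hb.mul hb', mul_ne_zero hb0 hb0', ?_⟩
  rw [div_mul_div_comm]
  simp

theorem funOf_zero (s : Finset DynVar) : FunOf s (0 : E.Fun) :=
  ⟨0, 1, dependsAnalytically_const s 0, dependsAnalytically_const s 1, one_ne_zero, by simp⟩

theorem exists_funOf (f : E.Fun) : ∃ s, FunOf s f := by
  obtain ⟨a, b, hb, rfl⟩ := exists_div f
  obtain ⟨s, ha', hb'⟩ := exists_common_vars a b
  exact ⟨s, a, b, ha', hb', hb, rfl⟩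

/-- The set t depends on s only: it collects the variables needed for the shifts of those in s. This
uniformity keeps one finite set for all i. -/
theorem exists_dependsAnalytically_shift (s : Finset DynVar) : ∃ t, ∀ a : E.analyticFun,
    DependsAnalytically s a.1 → DependsAnalytically t (shift a).1 := by
  classical
  choose y hy _ using shiftPoint_compatible (E := E)
  choose t ht using fun c => (y c).2
  refine ⟨s.biUnion t, fun a ha => ?_⟩
  obtain ⟨g, hg, hag⟩ := ha
  choose h hh hyh using fun c : s => (ht c).mono (Finset.subset_biUnion_of_mem t c.2)
  have hpt : ∀ Q, (fun c => h c (proj (s.biUnion t) Q)) =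
      proj (E := E.toPreEquation) s (shiftPoint Q) := fun Q =>
    funext fun c => by rw [← hyh]; exact hy c Q
  refine ⟨fun z => g fun c => h c z, ?_, fun P => ?_⟩
  · rintro _ ⟨Q, rfl⟩
    refine AnalyticAt.fun_comp (f := fun z => fun c => h c z) ?_
      (AnalyticAt.pi fun c => hh c _ ⟨Q, rfl⟩)
    rw [hpt]
    exact hg _ ⟨_, rfl⟩
  · show a.1 (shiftPoint P) = g fun c => h c (proj (s.biUnion t) P)
    rw [hpt]
    exact hag _

theorem exists_dependsAnalytically_totalDeriv (s : Finset DynVar) : ∃ t, s ⊆ t ∧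
    ∀ a : E.analyticFun, DependsAnalytically s a.1 → DependsAnalytically t (totalDeriv a).1 := by
  classical
  choose t ht using coordDeriv_mem (E := E)
  refine ⟨s ∪ s.biUnion t, Finset.subset_union_left, fun a ha => ?_⟩
  obtain ⟨g, hg, hag⟩ := ha
  have h1 : (totalDeriv a).1 = fun P => ∑ c : s,
      ((fun P => fderiv 𝕜 g (proj s P) (Pi.single c 1)) * coordDeriv c.1 : E.Point → 𝕜) P := by
    funext P
    rw [totalDeriv_apply a hg hag, fderiv_apply_eq_sum]
    rfl
  rw [h1]
  refine DependsAnalytically.sum _ fun c _ => DependsAnalytically.mul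
    (DependsAnalytically.mono Finset.subset_union_left
      ⟨fun z => fderiv 𝕜 g z (Pi.single c 1), fun z hz => ?_, fun P => rfl⟩)
    ((ht c.1).mono ((Finset.subset_biUnion_of_mem t c.2).trans Finset.subset_union_right))
  exact ((ContinuousLinearMap.apply 𝕜 𝕜 (Pi.single c 1 : s → 𝕜)).analyticAt _).fun_comp
    (hg z hz).fderiv

theorem exists_funOf_T (s : Finset DynVar) : ∃ t, ∀ f : E.Fun, FunOf s f → FunOf t (T f) := by
  obtain ⟨t, ht⟩ := exists_dependsAnalytically_shift (E := E) s
  refine ⟨t, ?_⟩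
  rintro _ ⟨a, b, ha, hb, hb0, rfl⟩
  exact ⟨shift a, shift b, ht a ha, ht b hb, (map_ne_zero_iff _ E.shiftEquiv.injective).2 hb0,
    T_div a b⟩

theorem exists_funOf_D (s : Finset DynVar) : ∃ t, ∀ f : E.Fun, FunOf s f → FunOf t (D f) := by
  obtain ⟨t, hst, ht⟩ := exists_dependsAnalytically_totalDeriv (E := E) s
  refine ⟨t, ?_⟩
  rintro _ ⟨a, b, ha, hb, hb0, rfl⟩
  refine ⟨b * totalDeriv a - a * totalDeriv b, b * b,
    ((hb.mono hst).mul (ht a ha)).sub ((ha.mono hst).mul (ht b hb)),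
    (hb.mono hst).mul (hb.mono hst), mul_ne_zero hb0 hb0, ?_⟩
  rw [D_div _ hb0, pow_two, map_mul (algebraMap _ E.Fun) b b]

theorem IsNonautonomousFun.Ti {f : ℤ → E.Fun} (hf : IsNonautonomousFun f) :
    IsNonautonomousFun (Ti f) := by
  obtain ⟨s, hs⟩ := hf
  obtain ⟨t, ht⟩ := exists_funOf_T (E := E) s
  exact ⟨t, fun i => ht _ (hs _)⟩

theorem IsNonautonomousFun.Di {f : ℤ → E.Fun} (hf : IsNonautonomousFun f) :
    IsNonautonomousFun (Di f) := by
  obtain ⟨s, hs⟩ := hf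
  obtain ⟨t, ht⟩ := exists_funOf_D (E := E) s
  exact ⟨t, fun i => ht _ (hs _)⟩

theorem isNonautonomousFun_const (k : E.Fun) : IsNonautonomousFun fun _ => k := by
  obtain ⟨s, hs⟩ := exists_funOf k
  exact ⟨s, fun _ => hs⟩

theorem isNonautonomousFun_single (j : ℤ) (k : E.Fun) :
    IsNonautonomousFun (Pi.single j k : ℤ → E.Fun) := by
  obtain ⟨s, hs⟩ := exists_funOf k
  refine ⟨s, fun i => ?_⟩
  rcases eq_or_ne i j with rfl | h
  · rw [Pi.single_eq_same]; exact hs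
  · rw [Pi.single_eq_of_ne h]; exact funOf_zero s

theorem IsNonautonomousFun.sum_mul (n : ℕ) (a : ℕ → E.Fun) {f : ℕ → ℤ → E.Fun}
    (hf : ∀ k, IsNonautonomousFun (f k)) :
    IsNonautonomousFun fun i => ∑ k ∈ Finset.range n, a k * f k i := by
  classical
  induction n with
  | zero => simpa using isNonautonomousFun_const (0 : E.Fun)
  | succ n ih =>
    obtain ⟨s, hs⟩ := ih
    obtain ⟨t, ht⟩ := hf n
    obtain ⟨r, hr⟩ := exists_funOf (a n)
    refine ⟨s ∪ (t ∪ r), fun i => ?_⟩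
    simp only [Finset.sum_range_succ]
    exact (FunOf.mono Finset.subset_union_left (hs i)).add
      (FunOf.mono Finset.subset_union_right ((hr.mono Finset.subset_union_right).mul
        (FunOf.mono Finset.subset_union_left (ht i))))

theorem IsNonautonomousFun.iterate {Z : (ℤ → E.Fun) → ℤ → E.Fun}
    (hZ : ∀ f, IsNonautonomousFun f → IsNonautonomousFun (Z f)) {f : ℤ → E.Fun}
    (hf : IsNonautonomousFun f) (k : ℕ) : IsNonautonomousFun (Z^[k] f) := by
  induction k with
  | zero => exact hf
  | succ k ih =>
    rw [Function.iterate_succ_apply']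
    exact hZ _ ih

end Equation

/-! ### Comparison of coefficients -/

namespace LinData

section Coefficients

universe u

variable {K : Type u} [Field K] (d : LinData K)

theorem iterate_T_D (k : ℕ) (e : K) : d.T^[k] (d.D e) = d.D (d.T^[k] e) :=
  (Function.Commute.iterate_left (show Function.Commute d.T d.D from d.comm) k) e

theorem lin_sum_t {M : Type*} [AddCommGroup M] [Module K M] (V : d.Rep M) (n : ℕ) (r : ℕ → K)
    {y : M} (hy : V.dd y = 0) :
    V.lin (∑ k ∈ Finset.range n, r k • (V.t ^ k) y) = ∑ k ∈ Finset.range n,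
      (d.phi (r k) • (V.t ^ (k + 1)) y - d.psi (r k) • (V.t ^ k) y) := by
  have h0 : V.lin 0 = 0 := by simp [Rep.lin, Rep.phi, Rep.psi]
  rw [show V.lin = ⇑(AddMonoidHom.mk' V.lin V.lin_add) from rfl, map_sum]
  refine Finset.sum_congr rfl fun k _ => ?_
  have hk : V.dd ((V.t ^ k) y) = 0 := by rw [← V.t_pow_dd, hy, map_zero]
  show V.lin _ = _
  simp only [Rep.lin, Rep.phi, Rep.psi, V.d_smul, V.t_smul, hk, smul_zero, add_zero, phi, psi,
    end_pow_succ']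
  module

theorem lin_sum_dd {M : Type*} [AddCommGroup M] [Module K M] (V : d.Rep M) (n : ℕ) (r : ℕ → K)
    {y : M} (hy : V.t y = y) :
    V.lin (∑ k ∈ Finset.range n, r k • (V.dd ^ k) y) = ∑ k ∈ Finset.range n,
      (d.lin (r k) • (V.dd ^ k) y + d.shiftSub (r k) • (V.dd ^ (k + 1)) y) := by
  rw [show V.lin = ⇑(AddMonoidHom.mk' V.lin V.lin_add) from rfl, map_sum]
  refine Finset.sum_congr rfl fun k _ => ?_
  have hk : V.t ((V.dd ^ k) y) = (V.dd ^ k) y := by rw [V.dd_pow_t, hy]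
  show V.lin _ = _
  simp only [Rep.lin, Rep.phi, Rep.psi, V.d_smul, V.t_smul, V.comm, hk, map_add, phi, psi, lin,
    shiftSub, end_pow_succ']
  module

theorem iterate_D_mul {x : K} (hx : d.D x = 1) (k : ℕ) (g : K) :
    d.D^[k + 1] (x * g) = x * d.D^[k + 1] g + (k + 1 : ℕ) • d.D^[k] g := by
  induction k with
  | zero => simp [d.leibniz, hx]; ring
  | succ k ih =>
    rw [Function.iterate_succ_apply', ih, map_add, map_nsmul, d.leibniz, hx,
      ← Function.iterate_succ_apply' d.D, ← Function.iterate_succ_apply' d.D,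
      add_smul (k + 1) 1]
    simp only [one_mul, one_smul]
    abel

theorem iterate_D_nsmul (k j : ℕ) (e : K) : d.D^[k] (j • e) = j • d.D^[k] e := by
  induction k with
  | zero => rfl
  | succ k ih => rw [Function.iterate_succ_apply', Function.iterate_succ_apply', ih, map_nsmul]

/-- A differential operator killing the powers of `x` is zero. -/
theorem left_coeff_eq_zero [CharZero K] {x : K} (hx : d.D x = 1) (n : ℕ) (w : ℕ → K)
    (h : ∀ j : ℕ, ∑ k ∈ Finset.range n, w k * d.D^[k] (x ^ j) = 0) : ∀ k < n, w k = 0 := by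
  induction n generalizing w with
  | zero => simp
  | succ n ih =>
    have hsucc : ∀ k < n, w (k + 1) = 0 := by
      intro k hk
      -- The commutator with x lowers the order: [D^{k+1}, x] = (k + 1) D^k. It also kills the
      -- powers of x, and characteristic zero recovers the coefficients.
      have := ih (fun k => w (k + 1) * (k + 1 : ℕ)) (fun j => ?_) k hk
      · exact (mul_eq_zero.1 this).resolve_right (Nat.cast_ne_zero.2 k.succ_ne_zero)
      · have h1 := h (j + 1)
        have h2 := congrArg (x * ·) (h j)
        rw [Finset.sum_range_succ'] at h1 h2
        simp only [mul_add, Finset.mul_sum, mul_zero, pow_succ', d.iterate_D_mul hx] at h1 h2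
        rw [Finset.sum_add_distrib] at h1
        simp only [Function.iterate_zero, id] at h1 h2
        calc _ = ∑ k ∈ Finset.range n, w (k + 1) * (k + 1 : ℕ) • d.D^[k] (x ^ j) :=
              Finset.sum_congr rfl fun k _ => by rw [nsmul_eq_mul]; ring
          _ = _ := by
              rw [Finset.sum_congr rfl fun k _ => mul_left_comm x (w (k + 1)) _] at h2
              linear_combination h1 - h2
    intro k hk
    cases k with
    | succ k => exact hsucc k (by omega)
    | zero =>
      have h0 := h 0
      rw [Finset.sum_range_succ', Finset.sum_eq_zero fun k hk => by
        rw [hsucc k (Finset.mem_range.1 hk), zero_mul]] at h0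
      simpa using h0

/-- A differential operator, written with the coefficients on the right, is determined by its
values. -/
theorem right_coeff_eq_zero [CharZero K] {x : K} (hx : d.D x = 1) (n : ℕ) (z : ℕ → K)
    (h : ∀ g : K, ∑ k ∈ Finset.range n, d.D^[k] (z k * g) = 0) : ∀ k < n, z k = 0 := by
  induction n generalizing z with
  | zero => simp
  | succ n ih =>
    have hsucc : ∀ k < n, z (k + 1) = 0 := by
      intro k hk
      have := ih (fun k => (k + 1 : ℕ) • z (k + 1)) (fun g => ?_) k hk
      · exact (smul_eq_zero.1 this).resolve_left k.succ_ne_zero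
      · have h1 := h (x * g)
        have h2 := congrArg (x * ·) (h g)
        rw [Finset.sum_range_succ'] at h1 h2
        simp only [mul_left_comm _ x, d.iterate_D_mul hx] at h1
        simp only [mul_add, Finset.mul_sum, mul_zero] at h2
        rw [Finset.sum_add_distrib] at h1
        simp only [Function.iterate_zero, id] at h1 h2
        calc _ = ∑ k ∈ Finset.range n, (k + 1 : ℕ) • d.D^[k] (z (k + 1) * g) :=
              Finset.sum_congr rfl fun k _ => by
                rw [smul_mul_assoc, iterate_D_nsmul]
          _ = _ := by linear_combination h1 - h2
    intro k hk
    cases k with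
    | succ k => exact hsucc k (by omega)
    | zero =>
      have h0 := h 1
      rw [Finset.sum_range_succ', Finset.sum_eq_zero fun k hk => by
        rw [hsucc k (Finset.mem_range.1 hk), zero_mul]; exact iterate_map_zero d.D _] at h0
      simpa using h0

/-- Differential operators can be rewritten with the coefficients on the right. -/
theorem exists_right_coeff (n : ℕ) (γ : ℕ → K) : ∃ s : ℕ → K, (∀ k, n ≤ k → s k = 0) ∧
    ∀ y : K, ∑ k ∈ Finset.range n, γ k * d.D^[k] y = ∑ k ∈ Finset.range n, d.D^[k] (s k * y) := by
  induction n generalizing γ with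
  | zero => exact ⟨0, by simp, by simp⟩
  | succ n ih =>
    obtain ⟨s, hs, h⟩ := ih fun k => γ (k + 1)
    refine ⟨fun k => (if k = 0 then γ 0 else s (k - 1)) - d.D (s k), fun k hk => ?_, fun y => ?_⟩
    · simp only
      rw [if_neg (by omega), hs _ (by omega), hs _ (by omega), map_zero, sub_zero]
    · simp only [sub_mul, iterate_map_sub, Finset.sum_sub_distrib]
      rw [Finset.sum_range_succ' (fun k => γ k * d.D^[k] y)]
      simp only [Function.iterate_succ_apply]
      rw [h, Finset.sum_range_succ' (fun k => d.D^[k] ((if k = 0 then γ 0 else s (k - 1)) * y)),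
        Finset.sum_range_succ (fun k => d.D^[k] (d.D (s k) * y)), hs n le_rfl, map_zero, zero_mul,
        iterate_map_zero, add_zero]
      have h1 : ∀ k, d.D^[k] (s k * d.D y) = d.D^[k + 1] (s k * y) - d.D^[k] (d.D (s k) * y) := by
        intro k
        rw [Function.iterate_succ_apply, ← iterate_map_sub, d.leibniz, add_sub_cancel_left]
      simp only [h1, Finset.sum_sub_distrib]
      simp
      ring

/-- The coefficients of `D ∑ μ_k T^k = ∑ ν_k T^k L` give a finite chain for the adjoint
operator. -/
theorem adjoint_chainR_of_coeff {x : K} (hDx : d.D x = 1) (hTx1 : d.T x = x) {m : ℕ} (hm : 0 < m)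
    {μ ν : ℕ → K} (hμm : μ m ≠ 0) (hν : ∀ k, m ≤ k → ν k = 0)
    (hprev : ∀ (j : ℕ) (κ : K), d.D (μ j * d.T^[j] κ) =
      (if j = 0 then 0 else ν (j - 1) * d.T^[j - 1] (d.phi κ)) - ν j * d.T^[j] (d.psi κ)) :
    d.adjoint.ChainR := by
  have hTx : ∀ k, d.T^[k] x = x := fun k =>
    Function.iterate_fixed hTx1 k
  have hphi1 : d.phi 1 = -d.b := by simp [LinData.phi, D_one]
  have hpsi1 : d.psi 1 = d.c := by simp [LinData.psi, D_one]
  have hphix : d.phi x = 1 - d.b * x := by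
    simp [LinData.phi, hDx, hTx1]
  have hpsix : d.psi x = d.a + d.c * x := by
    simp [LinData.psi, hDx]
  have hone : ∀ k, d.T^[k] 1 = 1 := fun k => iterate_map_one d.T k
  have hD0 : d.D (μ 0) = -(ν 0 * d.c) := by
    have := hprev 0 1
    simpa [hpsi1] using this
  have hμ0 : μ 0 = -(ν 0 * d.a) := by
    have := hprev 0 x
    simp only [Function.iterate_zero, id, if_true, hpsix, d.leibniz, hD0,
      hDx] at this
    linear_combination this
  have hDs : ∀ k, d.D (μ (k + 1)) = -(ν k * d.T^[k] d.b) -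
      ν (k + 1) * d.T^[k + 1] d.c := by
    intro k
    have := hprev (k + 1) 1
    simp only [hone, mul_one, hphi1, hpsi1, Nat.add_eq_zero_iff, one_ne_zero, and_false,
      if_false, Nat.add_sub_cancel, iterate_map_neg] at this
    rw [this]
    ring
  have hμs : ∀ k, μ (k + 1) = ν k - ν (k + 1) * d.T^[k + 1] d.a := by
    intro k
    have := hprev (k + 1) x
    simp only [hTx, hphix, hpsix, Nat.add_eq_zero_iff, one_ne_zero, and_false,
      if_false, Nat.add_sub_cancel, d.leibniz, hDs, hDx, iterate_map_sub,
      iterate_map_add, iterate_map_mul, hone] at this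
    linear_combination this
  -- Testing with κ = 1 and κ = x has given both D μ_k and μ_k in terms of ν; equating D of the
  -- latter with the former is the adjoint chain relation, once ν_k T^k is written as T^k n_k.
  obtain ⟨n, hn⟩ : ∃ n : ℕ → K, n = fun k => d.T.symm^[k] (ν k) := ⟨_, rfl⟩
  have hTn : ∀ k, d.T^[k] (n k) = ν k := fun k => by
    rw [hn]
    exact (Function.LeftInverse.iterate d.T.apply_symm_apply k) _
  have hνm : ν (m - 1) ≠ 0 := by
    obtain ⟨q, rfl⟩ := Nat.exists_eq_succ_of_ne_zero hm.ne'
    have h1 := hμs q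
    rw [hν _ le_rfl, zero_mul, sub_zero] at h1
    rwa [Nat.succ_sub_one, ← h1]
  refine ⟨n, ⟨m - 1, fun h0 => hνm ?_, fun k hk => ?_⟩, ?_, fun k => ?_⟩
  · rw [← hTn, h0, iterate_T_zero]
  · rw [hn]
    simp only
    rw [hν k (by omega)]
    exact iterate_map_zero _ _
  · have e := hTn 0
    simp only [Function.iterate_zero, id] at e
    have h1 := hD0
    rw [hμ0, map_neg, d.leibniz] at h1
    simp only [LinData.psi, adjoint, AddMonoidHom.neg_apply, e]
    linear_combination h1
  · apply (d.iterate_T_bijective (k + 1)).injective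
    have h1 := hDs k
    rw [hμs, map_sub, d.leibniz] at h1
    have e1 : d.T^[k + 1] (d.adjoint.phi (n k)) =
        -d.D (ν k) - d.T^[k] d.b * ν k := by
      rw [Function.iterate_succ_apply]
      simp only [LinData.phi, adjoint, AddMonoidHom.neg_apply, map_sub, map_mul, map_neg,
        RingEquiv.apply_symm_apply, iterate_map_sub, iterate_map_mul, iterate_map_neg,
        iterate_T_D, hTn]
    have e2 : d.T^[k + 1] (d.adjoint.psi (n (k + 1))) =
        -(d.T^[k + 1] d.a * d.D (ν (k + 1))) +
          (d.T^[k + 1] d.c - d.D (d.T^[k + 1] d.a)) * ν (k + 1) := by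
      simp only [LinData.psi, adjoint, AddMonoidHom.neg_apply, iterate_map_sub, iterate_map_add,
        iterate_map_mul, iterate_map_neg, iterate_T_D, hTn]
      ring
    rw [e1, e2]
    linear_combination -h1

end Coefficients

end LinData

/-! ### Drivers and formal integrals as finite chains -/

namespace Equation

open LinData

variable {𝕜 : Type*} [RCLike 𝕜] {E : Equation 𝕜}

theorem Ti_eq : (Ti : (ℤ → E.Fun) → ℤ → E.Fun) = E.data.seqT.t :=
  funext fun f => funext fun i => T_eq (f (i + 1))

theorem Di_eq : (Di : (ℤ → E.Fun) → ℤ → E.Fun) = E.data.seqT.dd := rfl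

theorem L_eq (f : ℤ → E.Fun) : L f = E.data.seqT.lin f := by
  funext i
  unfold L
  rw [Ti_eq, Di_eq]
  show _ = E.data.seqT.t (E.data.seqT.dd f) i - E.Fu1 * E.data.seqT.t f i -
    (E.Fux * E.data.seqT.dd f i + E.Fu * f i)
  ring

theorem opT_eq (n : ℕ) (a : ℕ → E.Fun) (f : ℤ → E.Fun) :
    opT n a f = ∑ k ∈ Finset.range n, a k • (E.data.seqT.t ^ k) f := by
  funext i
  simp only [opT, Ti_eq, Finset.sum_apply, AddMonoid.End.coe_pow]
  rfl

theorem opD_eq (n : ℕ) (a : ℕ → E.Fun) (f : ℤ → E.Fun) :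
    opD n a f = ∑ k ∈ Finset.range n, a k • (E.data.seqT.dd ^ k) f := by
  funext i
  simp only [opD, Di_eq, Finset.sum_apply, AddMonoid.End.coe_pow]
  rfl

theorem data_D_xFun : E.data.D E.xFun = 1 := D_xFun

theorem data_T_xFun : E.data.T E.xFun = E.xFun := (T_eq _).symm.trans T_xFun

theorem exists_iSymmetryDriver_iff :
    (∃ (r : ℕ) (lam : ℕ → E.Fun), IsISymmetryDriver r lam) ↔ E.data.ChainR := by
  constructor
  · rintro ⟨p, lam, hp, h⟩
    -- `lam` is arbitrary beyond p, while a finite chain must vanish there.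
    obtain ⟨r, hr⟩ : ∃ r : ℕ → E.Fun, r = fun k => if k < p + 1 then lam k else 0 := ⟨_, rfl⟩
    have hlt : ∀ k, k < p + 1 → r k = lam k := fun k hk => by simp only [hr, if_pos hk]
    have hge : ∀ k, ¬ k < p + 1 → r k = 0 := fun k hk => by simp only [hr, if_neg hk]
    have hη : E.data.seqT.dd (Pi.single 0 1) = 0 := by
      funext i
      show E.data.D (Pi.single (M := fun _ : ℤ => E.Fun) 0 1 i) = 0
      rcases eq_or_ne i 0 with rfl | hi
      · rw [Pi.single_eq_same, D_one]
      · rw [Pi.single_eq_of_ne hi, map_zero]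
    -- The delta sequence is admissible because explicit dependence on i is allowed; evaluation at
    -- -j isolates the coefficient of T^j.
    have h1 := (h (Pi.single 0 1) (isNonautonomousFun_single 0 1) hη).2
    rw [L_eq, opT_eq, lin_sum_t _ _ _ _ hη] at h1
    have h2 : ∀ j : ℕ, ∑ k ∈ Finset.range (p + 1), ((if k + 1 = j then E.data.phi (r k) else 0) -
        if k = j then E.data.psi (r k) else 0) = 0 := by
      intro j
      have h3 := congrFun h1 (-j)
      rw [Finset.sum_apply] at h3
      refine Eq.trans (Finset.sum_congr rfl fun k hk => ?_) h3
      rw [hlt k (Finset.mem_range.1 hk)]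
      simp only [Pi.sub_apply, Pi.smul_apply, seqT_t_pow]
      have hs : ∀ l : ℕ, E.data.T^[l] (Pi.single (M := fun _ : ℤ => E.Fun) 0 1 (-(j : ℤ) + l)) =
          if l = j then 1 else 0 := by
        intro l
        split_ifs with hl
        · rw [hl, neg_add_cancel, Pi.single_eq_same]
          exact iterate_map_one E.data.T j
        · rw [Pi.single_eq_of_ne (by omega), iterate_T_zero]
      simp only [hs, smul_eq_mul, mul_ite, mul_one, mul_zero]
    refine ⟨r, ⟨p, by rwa [hlt p (by omega)], fun k hk => hge k (by omega)⟩, ?_, fun k => ?_⟩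
    · have := h2 0
      simp only [Nat.add_eq_zero_iff, one_ne_zero, and_false, if_false, zero_sub,
        Finset.sum_neg_distrib, Finset.sum_ite_eq', Finset.mem_range] at this
      rw [if_pos (by omega)] at this
      exact neg_eq_zero.1 this
    · have := h2 (k + 1)
      simp only [add_left_inj, Finset.sum_sub_distrib, Finset.sum_ite_eq', Finset.mem_range] at this
      have e1 : E.data.phi (r k) = if k < p + 1 then E.data.phi (r k) else 0 := by
        split_ifs with hk
        · rfl
        · rw [hge k hk, phi_zero]
      have e2 : E.data.psi (r (k + 1)) = if k + 1 < p + 1 then E.data.psi (r (k + 1)) else 0 := by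
        split_ifs with hk
        · rfl
        · rw [hge _ hk, psi_zero]
      rw [e1, e2]
      exact sub_eq_zero.1 this
  · rintro ⟨r, ⟨p, hp, htop⟩, h0, hr⟩
    refine ⟨p, r, hp, fun η hη hD => ⟨?_, ?_⟩⟩
    · exact IsNonautonomousFun.sum_mul _ _ fun k => hη.iterate (fun _ => IsNonautonomousFun.Ti) k
    · rw [L_eq, opT_eq, lin_sum_t _ _ _ _ hD]
      simp only [hr]
      rw [Finset.sum_range_sub fun k => E.data.psi (r k) • (E.data.seqT.t ^ k) η, h0,
        htop _ (Nat.lt_succ_self p), psi_zero]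
      simp

theorem iterate_Di_const (k : ℕ) (e : E.Fun) :
    (E.data.seqT.dd ^ k) (fun _ => e) = fun _ => E.data.D^[k] e := by
  induction k with
  | zero => rfl
  | succ k ih => rw [end_pow_succ', ih, Function.iterate_succ_apply']; rfl

theorem exists_xSymmetryDriver_iff :
    (∃ (σ : ℕ) (α : ℕ → E.Fun), IsXSymmetryDriver σ α) ↔ E.data.ChainS := by
  constructor
  · rintro ⟨p, α, hp, h⟩
    obtain ⟨s, hs⟩ : ∃ s : ℕ → E.Fun, s = fun k => if k < p + 1 then α k else 0 := ⟨_, rfl⟩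
    have hlt : ∀ k, k < p + 1 → s k = α k := fun k hk => by simp only [hs, if_pos hk]
    have hge : ∀ k, ¬ k < p + 1 → s k = 0 := fun k hk => by simp only [hs, if_neg hk]
    have hsub0 : E.data.shiftSub 0 = 0 := by simp [LinData.shiftSub]
    obtain ⟨w, hw⟩ : ∃ w : ℕ → E.Fun, w = fun k => E.data.lin (s k) +
      if k = 0 then 0 else E.data.shiftSub (s (k - 1)) := ⟨_, rfl⟩
    have hw0 : ∀ k < p + 2, w k = 0 := by
      -- The powers of x, taken independent of i, lie in ker(T - 1) and suffice to determine a
      -- differential operator.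
      refine E.data.left_coeff_eq_zero data_D_xFun _ _ fun j => ?_
      have hξ : E.data.seqT.t (fun _ => E.xFun ^ j) = fun _ => E.xFun ^ j := by
        funext i
        show E.data.T (E.xFun ^ j) = _
        rw [map_pow, data_T_xFun]
      have h1 := (h (fun _ => E.xFun ^ j) (isNonautonomousFun_const _) (by rw [Ti_eq, hξ])).2
      rw [L_eq, opD_eq, lin_sum_dd _ _ _ _ hξ] at h1
      have h2 := congrFun h1 0
      rw [Finset.sum_apply] at h2
      simp only [iterate_Di_const, Pi.add_apply, Pi.smul_apply, smul_eq_mul, Pi.zero_apply,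
        Finset.sum_add_distrib] at h2
      simp only [hw, add_mul, Finset.sum_add_distrib]
      refine Eq.trans ?_ h2
      congr 1
      · rw [Finset.sum_range_succ, hge (p + 1) (by omega), lin_zero, zero_mul, add_zero]
        exact Finset.sum_congr rfl fun k hk => by rw [hlt k (Finset.mem_range.1 hk)]
      · rw [Finset.sum_range_succ' (n := p + 1), if_pos rfl, zero_mul, add_zero]
        exact Finset.sum_congr rfl fun k hk => by
          rw [if_neg (by omega), Nat.add_sub_cancel, hlt k (Finset.mem_range.1 hk)]
    refine ⟨s, ⟨p, by rwa [hlt p (by omega)], fun k hk => hge k (by omega)⟩, ?_, fun k => ?_⟩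
    · have := hw0 0 (by omega)
      simp only [hw, if_true, add_zero] at this
      exact neg_eq_zero.2 this
    · by_cases hk : k + 1 < p + 2
      · have := hw0 (k + 1) hk
        simp only [hw, Nat.add_eq_zero_iff, one_ne_zero, and_false, if_false,
          Nat.add_sub_cancel] at this
        exact eq_neg_of_add_eq_zero_right this
      · rw [hge k (by omega), hge (k + 1) (by omega), hsub0]
        exact (neg_eq_zero.2 (lin_zero _)).symm
  · rintro ⟨s, ⟨p, hp, htop⟩, h0, hs⟩
    refine ⟨p, s, hp, fun ξ hξ hT => ⟨?_, ?_⟩⟩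
    · exact IsNonautonomousFun.sum_mul _ _ fun k => hξ.iterate (fun _ => IsNonautonomousFun.Di) k
    · rw [Ti_eq] at hT
      rw [L_eq, opD_eq, lin_sum_dd _ _ _ _ hT]
      have key : ∀ k, E.data.lin (s k) • (E.data.seqT.dd ^ k) ξ +
          E.data.shiftSub (s k) • (E.data.seqT.dd ^ (k + 1)) ξ =
          -(E.data.lin (s (k + 1)) • (E.data.seqT.dd ^ (k + 1)) ξ -
            E.data.lin (s k) • (E.data.seqT.dd ^ k) ξ) := by
        intro k
        rw [hs, neg_smul]
        abel
      simp only [key, Finset.sum_neg_distrib]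
      rw [Finset.sum_range_sub fun k => E.data.lin (s k) • (E.data.seqT.dd ^ k) ξ,
        neg_eq_zero.1 h0, htop _ (Nat.lt_succ_self p), lin_zero]
      simp

theorem sumT_eq (P : ℕ) (n : ℕ → E.Fun) (f : ℤ → E.Fun) :
    E.data.seqT.sumT P n f = opT P (fun k => E.data.T^[k] (n k)) f := by
  rw [opT_eq, Rep.sumT]
  simp only [Rep.t_pow_smul]

theorem seqT_lin_single (κ : E.Fun) (i : ℤ) : E.data.seqT.lin (Pi.single 0 κ) i =
    (if i = -1 then E.data.phi κ else 0) - if i = 0 then E.data.psi κ else 0 := by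
  show E.data.phi (Pi.single (M := fun _ : ℤ => E.Fun) 0 κ (i + 1)) -
    E.data.psi (Pi.single (M := fun _ : ℤ => E.Fun) 0 κ i) = _
  congr 1
  · split_ifs with h
    · rw [h, neg_add_cancel, Pi.single_eq_same]
    · rw [Pi.single_eq_of_ne (by omega), phi_zero]
  · split_ifs with h
    · rw [h, Pi.single_eq_same]
    · rw [Pi.single_eq_of_ne h, psi_zero]

theorem exists_formalIIntegral_iff :
    (∃ (m : ℕ) (μ : ℕ → E.Fun), IsFormalIIntegral m μ) ↔ E.data.adjoint.ChainR := by
  constructor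
  · rintro ⟨m, μ₀, hm, hμm, ν₀, h⟩
    obtain ⟨μ, hμ⟩ : ∃ μ : ℕ → E.Fun, μ = fun k => if k < m + 1 then μ₀ k else 0 := ⟨_, rfl⟩
    obtain ⟨ν, hν⟩ : ∃ ν : ℕ → E.Fun, ν = fun k => if k < m then ν₀ k else 0 := ⟨_, rfl⟩
    have hprev : ∀ (j : ℕ) (κ : E.Fun), E.data.D (μ j * E.data.T^[j] κ) =
        (if j = 0 then 0 else ν (j - 1) * E.data.T^[j - 1] (E.data.phi κ)) -
          ν j * E.data.T^[j] (E.data.psi κ) := by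
      intro j κ
      have h1 := congrFun (h _ (isNonautonomousFun_single 0 κ)) (-j)
      rw [L_eq, opT_eq, opT_eq, Finset.sum_apply] at h1
      rw [show Di (∑ k ∈ Finset.range (m + 1), μ₀ k • (E.data.seqT.t ^ k) (Pi.single 0 κ)) (-j) =
        E.data.D ((∑ k ∈ Finset.range (m + 1), μ₀ k • (E.data.seqT.t ^ k) (Pi.single 0 κ)) (-j))
        from rfl, Finset.sum_apply] at h1
      simp only [Pi.smul_apply, seqT_t_pow, seqT_lin_single, smul_eq_mul] at h1
      have e1 : ∀ k : ℕ, μ₀ k * E.data.T^[k] (Pi.single (M := fun _ : ℤ => E.Fun) 0 κ (-(j : ℤ) + k))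
          = if k = j then μ₀ k * E.data.T^[k] κ else 0 := by
        intro k
        split_ifs with hk
        · rw [hk, neg_add_cancel, Pi.single_eq_same]
        · rw [Pi.single_eq_of_ne (by omega), iterate_T_zero, mul_zero]
      have e2 : ∀ k : ℕ, ν₀ k * E.data.T^[k] ((if -(j : ℤ) + k = -1 then E.data.phi κ else 0) -
          if -(j : ℤ) + k = 0 then E.data.psi κ else 0) =
          (if k + 1 = j then ν₀ k * E.data.T^[k] (E.data.phi κ) else 0) -
            if k = j then ν₀ k * E.data.T^[k] (E.data.psi κ) else 0 := by
        intro k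
        rw [iterate_map_sub, mul_sub]
        congr 1
        · by_cases hk : k + 1 = j
          · rw [if_pos (by omega), if_pos hk]
          · rw [if_neg (by omega), if_neg hk, iterate_T_zero, mul_zero]
        · by_cases hk : k = j
          · rw [if_pos (by omega), if_pos hk]
          · rw [if_neg (by omega), if_neg hk, iterate_T_zero, mul_zero]
      simp only [e1, e2, Finset.sum_sub_distrib, Finset.sum_ite_eq', Finset.mem_range] at h1
      have e3 : μ j * E.data.T^[j] κ = if j < m + 1 then μ₀ j * E.data.T^[j] κ else 0 := by
        simp only [hμ]
        split_ifs <;> simp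
      have e4 : ν j * E.data.T^[j] (E.data.psi κ) =
          if j < m then ν₀ j * E.data.T^[j] (E.data.psi κ) else 0 := by
        simp only [hν]
        split_ifs <;> simp
      rw [e3, e4, h1]
      congr 1
      cases j with
      | zero => simp
      | succ j =>
        simp only [add_left_inj, Finset.sum_ite_eq', Finset.mem_range, Nat.add_eq_zero_iff,
          one_ne_zero, and_false, if_false, Nat.add_sub_cancel, hν]
        split_ifs <;> simp
    refine E.data.adjoint_chainR_of_coeff data_D_xFun data_T_xFun hm (by simpa [hμ] using hμm)
      (fun k hk => ?_) hprev
    simp only [hν]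
    exact if_neg (by omega)
  · rintro ⟨n, ⟨p, hp, htop⟩, h0, hn⟩
    -- These are the coefficients of N(T - a); the leading one is T^p(n_p), of degree p + 1.
    refine ⟨p + 1, fun k => (if k = 0 then 0 else E.data.T^[k - 1] (n (k - 1))) -
      E.data.T^[k] (n k * E.data.a), Nat.succ_pos p, ?_, fun k => E.data.T^[k] (n k),
      fun f _ => ?_⟩
    · simp only [Nat.add_eq_zero_iff, one_ne_zero, and_false, if_false, Nat.add_sub_cancel]
      rw [htop _ (Nat.lt_succ_self p), zero_mul, iterate_T_zero, sub_zero]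
      exact fun h => hp ((E.data.iterate_T_bijective p).injective
        (h.trans (E.data.iterate_T_zero p).symm))
    · rw [L_eq, ← sumT_eq, ← E.data.seqT.dd_sumT (htop _ (Nat.lt_succ_self p)) h0 hn, Di_eq]
      congr 1
      rw [opT_eq]
      simp only [sub_smul, Finset.sum_sub_distrib]
      rw [Finset.sum_range_succ', Finset.sum_range_succ (n := p + 1)]
      simp only [Nat.add_eq_zero_iff, one_ne_zero, and_false, if_false, if_true,
        Nat.add_sub_cancel, htop _ (Nat.lt_succ_self p), zero_mul, iterate_T_zero, zero_smul,
        add_zero]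
      rw [← Finset.sum_sub_distrib, Rep.sumT]
      refine Finset.sum_congr rfl fun k _ => ?_
      rw [Rep.shiftSub, smul_sub, map_sub, Rep.t_pow_smul, ← end_pow_succ, smul_smul,
        Rep.t_pow_smul]

theorem exists_formalXIntegral_iff :
    (∃ (n : ℕ) (β : ℕ → E.Fun), IsFormalXIntegral n β) ↔ E.data.adjoint.ChainS := by
  constructor
  · rintro ⟨n, β, hn, hβ, γ, h⟩
    obtain ⟨s, hs0, hs⟩ := E.data.exists_right_coeff n γ
    have hdd : ∀ (k : ℕ) (f : ℤ → E.Fun) (i : ℤ),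
        (E.data.seqT.dd ^ k) f i = E.data.D^[k] (f i) := by
      intro k f i
      induction k with
      | zero => rfl
      | succ k ih =>
        rw [end_pow_succ', Function.iterate_succ_apply', ← ih]
        rfl
    -- Testing on κ placed at index 0 and evaluating at -1 and 0 separates the terms with T from
    -- those without: T X = Γφ and X = Γψ.
    have hid : ∀ κ, E.data.T (∑ k ∈ Finset.range (n + 1), β k * E.data.D^[k] κ) =
        E.data.base.sumD n s (E.data.phi κ) ∧
        ∑ k ∈ Finset.range (n + 1), β k * E.data.D^[k] κ =
          E.data.base.sumD n s (E.data.psi κ) := by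
      intro κ
      have h1 := h _ (isNonautonomousFun_single 0 κ)
      rw [Ti_eq, opD_eq, opD_eq, L_eq] at h1
      have hsum : ∀ y, E.data.base.sumD n s y = ∑ k ∈ Finset.range n, γ k * E.data.D^[k] y := by
        intro y
        rw [hs, Rep.sumD]
        simp only [AddMonoid.End.coe_pow]
        rfl
      have h2 : ∀ i : ℤ, E.data.T (∑ k ∈ Finset.range (n + 1),
          β k * E.data.D^[k] (Pi.single (M := fun _ : ℤ => E.Fun) 0 κ (i + 1))) -
          ∑ k ∈ Finset.range (n + 1),
            β k * E.data.D^[k] (Pi.single (M := fun _ : ℤ => E.Fun) 0 κ i) =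
          E.data.base.sumD n s (E.data.seqT.lin (Pi.single 0 κ) i) := by
        intro i
        have h3 := congrFun h1 i
        rw [Pi.sub_apply] at h3
        rw [show E.data.seqT.t (∑ k ∈ Finset.range (n + 1),
          β k • (E.data.seqT.dd ^ k) (Pi.single 0 κ)) i = E.data.T ((∑ k ∈ Finset.range (n + 1),
          β k • (E.data.seqT.dd ^ k) (Pi.single 0 κ)) (i + 1)) from rfl] at h3
        simp only [Finset.sum_apply, Pi.smul_apply, hdd, smul_eq_mul] at h3
        rw [h3, hsum]
      have hz : ∑ k ∈ Finset.range (n + 1), β k * E.data.D^[k] 0 = 0 :=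
        Finset.sum_eq_zero fun k _ => by rw [iterate_map_zero, mul_zero]
      constructor
      · have h3 := h2 (-1)
        rw [neg_add_cancel, Pi.single_eq_same, Pi.single_eq_of_ne (by omega), hz,
          seqT_lin_single] at h3
        simpa using h3
      · have h3 := h2 0
        rw [Pi.single_eq_same, Pi.single_eq_of_ne (by omega), hz, seqT_lin_single] at h3
        simp only [map_zero, zero_sub, if_true] at h3
        rw [if_neg (by omega), zero_sub] at h3
        have h4 := E.data.base.sumD_add n s (E.data.psi κ) (-E.data.psi κ)
        rw [add_neg_cancel, ← h3, ← sub_eq_add_neg] at h4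
        rw [← sub_eq_zero.1 (h4.symm.trans (by simp [Rep.sumD]))]
    -- If Γ were zero, X = Γψ would kill all powers of x, contradicting `β n ≠ 0`.
    have hne : ∃ k, s k ≠ 0 := by
      by_contra! hall
      refine hβ (E.data.left_coeff_eq_zero data_D_xFun (n + 1) β (fun j => ?_) n (by omega))
      rw [(hid _).2]
      simp [Rep.sumD, hall]
    have hlin0 : E.data.adjoint.lin 0 = 0 := lin_zero _
    have hsub0 : E.data.adjoint.shiftSub 0 = 0 := by simp [LinData.shiftSub]
    obtain ⟨z, hz⟩ : ∃ z : ℕ → E.Fun, z = fun k =>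
      (if k = 0 then 0 else -E.data.T (E.data.adjoint.shiftSub (s (k - 1)))) +
        -E.data.T (E.data.adjoint.lin (s k)) := ⟨_, rfl⟩
    have hz0 : ∀ k < n + 1, z k = 0 := by
      refine E.data.right_coeff_eq_zero data_D_xFun _ _ fun g => ?_
      -- The identity TΓψ κ = Γφ κ has its coefficients acting on T κ, which is an arbitrary
      -- element.
      obtain ⟨κ, rfl⟩ := E.data.T.surjective g
      have h1 : E.data.base.t (E.data.base.sumD n s (E.data.base.psi κ)) =
          E.data.base.sumD n s (E.data.base.phi κ) :=
        (congrArg E.data.T (hid κ).2).symm.trans (hid κ).1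
      rw [← sub_eq_zero, Rep.sumD, Rep.sumD, map_sum, ← Finset.sum_sub_distrib] at h1
      rw [Finset.sum_congr rfl fun k _ =>
        E.data.base.t_dd_pow_psi_sub k (s k) κ, Finset.sum_add_distrib] at h1
      rw [← h1]
      simp only [hz, add_mul, iterate_map_add, Finset.sum_add_distrib, AddMonoid.End.coe_pow]
      congr 1
      · rw [Finset.sum_range_succ']
        simp only [Nat.add_eq_zero_iff, one_ne_zero, and_false, if_false, if_true, zero_mul,
          Function.iterate_zero, id, add_zero, Nat.add_sub_cancel]
        rfl
      · rw [Finset.sum_range_succ, hs0 n le_rfl, hlin0, map_zero, neg_zero, zero_mul,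
          iterate_map_zero, add_zero]
        rfl
    obtain ⟨p, -, hp, htop⟩ := exists_top hs0 hne
    refine ⟨s, ⟨p, hp, htop⟩, ?_, fun k => ?_⟩
    · have := hz0 0 (by omega)
      simpa [hz] using this
    · by_cases hk : k + 1 < n + 1
      · have := hz0 (k + 1) hk
        simp only [hz, Nat.add_eq_zero_iff, one_ne_zero, and_false, if_false,
          Nat.add_sub_cancel] at this
        rw [← neg_add, neg_eq_zero, ← map_add, map_eq_zero_iff _ E.data.T.injective] at this
        exact eq_neg_of_add_eq_zero_left this
      · rw [hs0 k (by omega), hs0 (k + 1) (by omega), hsub0]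
        exact (neg_eq_zero.2 hlin0).symm
  · rintro ⟨s, ⟨p, hp, htop⟩, h0, hs⟩
    have hsP := htop _ (Nat.lt_succ_self p)
    obtain ⟨γ, -, hγ⟩ := E.data.exists_left_coeff p s
    obtain ⟨β, hβ, hβs⟩ := E.data.exists_left_coeff_sumD_psi hp hsP
    refine ⟨p + 1, β, Nat.succ_pos p, hβ, γ, fun f _ => ?_⟩
    rw [Ti_eq, opD_eq, opD_eq, ← hβs, ← hγ, L_eq]
    exact E.data.seqT.t_sumD_sub hsP h0 hs f

end Equation

end SemiDiscrete

theorem theorem1 {𝕜 : Type*} [RCLike 𝕜] (E : SemiDiscrete.Equation 𝕜) :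
    ((∃ (m : ℕ) (μ : ℕ → E.Fun), SemiDiscrete.Equation.IsFormalIIntegral m μ) ∧
      (∃ (n : ℕ) (β : ℕ → E.Fun), SemiDiscrete.Equation.IsFormalXIntegral n β)) ↔
    ((∃ (r : ℕ) (lam : ℕ → E.Fun), SemiDiscrete.Equation.IsISymmetryDriver r lam) ∧
      (∃ (σ : ℕ) (α : ℕ → E.Fun), SemiDiscrete.Equation.IsXSymmetryDriver σ α)) := by
  rw [SemiDiscrete.Equation.exists_formalIIntegral_iff,
    SemiDiscrete.Equation.exists_formalXIntegral_iff,
    SemiDiscrete.Equation.exists_iSymmetryDriver_iff,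
    SemiDiscrete.Equation.exists_xSymmetryDriver_iff]
  exact E.data.chains_iff_adjoint
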